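/- Let $n\ge 0$, $N=2n+2$ and $0\le m<n+1$. Let $V$ be a complex vector space of dimension $N$ with a non-degenerate symmetric bilinear form $(\cdot,\cdot)$, and let $\mathrm{OG}=\mathrm{OG}(m,N)$ be the variety of $m$-dimensional isotropic subspaces of $V$. Let $0=F_0\subsetneq F_1\subsetneq\dots\subsetneq F_N=V$ be an isotropic flag, i.e. a complete flag with $F_i=F_j^\perp$ whenever $i+j=N$, and let $e_1,\dots,e_N$ be a basis of $V$ with $(e_i,e_j)=\delta_{i+j,N+1}$ and $F_p=\langle e_1,\dots,e_p\rangle$ for each $p$. Let $B\subset \mathrm{SO}(V)$ be the stabilizer of $F_\bullet$. An \emph{index set} is a subset $P=\{p_1<\dots<p_m\}\subset[1,N]$ of cardinality $m$ such that $i+j\neq N+1$ for all $i,j\in P$. The Schubert variety $X_P\subset\mathrm{OG}$ is the Zariski closure of the $B$-orbit of the point $\langle e_p : p\in P\rangle$. Set $\overline{p}_j=n+2$ if $p_j=n+1$ and $\overline{p}_j=p_j$ otherwise, and \[ Y_P=\{\Sigma\in\mathrm{OG} \mid \dim(\Sigma\cap F_{\overline{p}_j})\ge j \text{ for } 1\le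 j\le m\}. \] Let $[P]=P\cup\{N+1-p\mid p\in P\}$. Set $\mathrm{type}(P)=0$ if $P\cap\{n+1,n+2\}=\emptyset$; otherwise $\mathrm{type}(P)\in\{1,2\}$ is $1$ plus the parity ($0$ or $1$) of the number of integers in $[1,n+1]\smallsetminus P$. Let $\iota(P)$ be the index set obtained from $P$ by interchanging $n+1$ and $n+2$. For index sets $P=\{p_1<\dots<p_m\}$ and $Q=\{q_1<\dots<q_m\}$ write $Q\le P$ if $q_j\le p_j$ for all $j$. The pair $(Q,P)$ is \emph{critical} if there is an integer $c\le n+1$ with $[c,n+1]\subset[P]\cap[Q]$ and $\#(Q\cap[1,c-1])=\#(P\cap[1,c-1])$. Write $Q\preceq P$ if $Q\le P$ and, in case $(Q,P)$ is critical, $\mathrm{type}(Q)=\mathrm{type}(P)$. \textbf{Proposition.} For any index set $P$, the Schubert variety $X_P$ is equal to the set of all $\Sigma\in Y_P$ such that for all integers $c\le n+1$ with $[c,n+1]\subset[P]$ we have $\dim(\Sigma\cap F_{c-1})>\#(P\cap[1,c-1])$ or \[ \dim((\Sigma+F_{c-1})\cap F_{n+1})\equiv c-1+\#(P\cap[c,n+1])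 \pmod 2 . \] If $\mathrm{type}(P)=0$, then $X_P=Y_P$, while if $\mathrm{type}(P)>0$, then $X_P\cup X_{\iota(P)}=Y_P$. For any two index sets $P$ and $Q$, we have $X_Q\subset X_P$ if and only if $Q\preceq P$. -/

import Mathlib

/-! Schubert varieties in the even orthogonal Grassmannian `OG(m, 2n+2)` over `ℂ`. -/

noncomputable section

namespace EvenOG

/-- The interval `[1, N]`, used to number basis vectors. -/
abbrev Idx (N : ℕ) : Type := {i : ℕ // i ∈ Finset.Icc 1 N}

/-- Index sets: subsets `P ⊆ [1, 2n+2]` of cardinality `m` such that no two elements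
(possibly equal) of `P` have sum `N + 1 = 2n+3`. -/
@[ext]
structure IndexSet (n m : ℕ) where
  carrier : Finset ℕ
  subset_Icc : carrier ⊆ Finset.Icc 1 (2 * n + 2)
  card_eq : carrier.card = m
  add_ne : ∀ i ∈ carrier, ∀ j ∈ carrier, i + j ≠ 2 * n + 3

namespace IndexSet

variable {n m : ℕ}

/-- The elements of `P` in increasing order; `P.elt j` is the `(j+1)`-st smallest element,
where `j` runs over `0, …, m-1`. -/
def elt (P : IndexSet n m) (j : Fin m) : ℕ :=
  P.carrier.orderEmbOfFin P.card_eq j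

/-- The elements of `P`, in increasing order, with `n+1` replaced by `n+2`. -/
def barElt (P : IndexSet n m) (j : Fin m) : ℕ :=
  if P.elt j = n + 1 then n + 2 else P.elt j

/-- The type of an index set, an integer in `{0, 1, 2}`. -/
def type (P : IndexSet n m) : ℕ :=
  if P.carrier ∩ {n + 1, n + 2} = ∅ then 0
  else 1 + (Finset.Icc 1 (n + 1) \ P.carrier).card % 2

/-- The symmetrization `[P] = P ∪ {N + 1 - p | p ∈ P}`. -/
def sym (P : IndexSet n m) : Finset ℕ :=
  P.carrier ∪ P.carrier.image (fun p => 2 * n + 3 - p)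

/-- `P.count a b` is the number of elements of `P` in the interval `[a, b]`. -/
def count (P : IndexSet n m) (a b : ℕ) : ℕ :=
  (P.carrier ∩ Finset.Icc a b).card

/-- The involution on index sets that interchanges `n+1` and `n+2`. -/
def iota (P : IndexSet n m) : IndexSet n m where
  carrier := P.carrier.image (Equiv.swap (n + 1) (n + 2))
  subset_Icc := by
    intro x hx
    obtain ⟨p, hp, rfl⟩ := Finset.mem_image.1 hx
    have h := Finset.mem_Icc.1 (P.subset_Icc hp)
    rw [Finset.mem_Icc, Equiv.swap_apply_def]
    split_ifs <;> omega
  card_eq := by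
    rw [Finset.card_image_of_injective _ (Equiv.injective _), P.card_eq]
  add_ne := by
    intro x hx y hy
    obtain ⟨p, hp, rfl⟩ := Finset.mem_image.1 hx
    obtain ⟨q, hq, rfl⟩ := Finset.mem_image.1 hy
    have h := P.add_ne p hp q hq
    rw [Equiv.swap_apply_def, Equiv.swap_apply_def]
    split_ifs <;> omega

/-- The componentwise order `Q ≤ P`. -/
def Le (Q P : IndexSet n m) : Prop :=
  ∀ j : Fin m, Q.elt j ≤ P.elt j

/-- The pair `(Q, P)` is critical: there is a critical index `c ≤ n+1`. -/
def Critical (Q P : IndexSet n m) : Prop :=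
  ∃ c : ℕ, 1 ≤ c ∧ c ≤ n + 1 ∧ Finset.Icc c (n + 1) ⊆ P.sym ∩ Q.sym ∧
    Q.count 1 (c - 1) = P.count 1 (c - 1)

/-- The relation `Q ⪯ P`. -/
def Prec (Q P : IndexSet n m) : Prop :=
  Q.Le P ∧ (Q.Critical P → Q.type = P.type)

end IndexSet

variable {V : Type*} [AddCommGroup V] [Module ℂ V]

/-- A complete isotropic flag `0 = F_0 ⊊ F_1 ⊊ ⋯ ⊊ F_N = V` with `F_i = F_j^⊥` whenever
`i + j = N`. The values `F p` for `p > N` are irrelevant. -/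
structure IsIsotropicFlag (b : LinearMap.BilinForm ℂ V) (N : ℕ) (F : ℕ → Submodule ℂ V) :
    Prop where
  bot : F 0 = ⊥
  top : F N = ⊤
  lt_succ : ∀ i < N, F i < F (i + 1)
  perp : ∀ i j, i + j = N → F i = b.orthogonal (F j)

/-- The basis `e_1, …, e_N` satisfies `(e_i, e_j) = δ_{i+j, N+1}` and
`F_p = ⟨e_1, …, e_p⟩`. -/
structure IsAdapted (b : LinearMap.BilinForm ℂ V) (N : ℕ) (F : ℕ → Submodule ℂ V)
    (e : Module.Basis (Idx N) ℂ V) : Prop where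
  pairing : ∀ i j : Idx N, b (e i) (e j) = if (i : ℕ) + (j : ℕ) = N + 1 then 1 else 0
  flag : ∀ p ≤ N, F p = Submodule.span ℂ (e '' {i | (i : ℕ) ≤ p})

/-- The orthogonal Grassmannian: the `m`-dimensional isotropic subspaces of `V`. -/
def OG (b : LinearMap.BilinForm ℂ V) (m : ℕ) : Set (Submodule ℂ V) :=
  {S | Module.finrank ℂ S = m ∧ ∀ x ∈ S, ∀ y ∈ S, b x y = 0}

/-- The Borel subgroup of `SO(V)` that stabilizes the flag `F`, as a set of automorphisms. -/
def borel (b : LinearMap.BilinForm ℂ V) (N : ℕ) (F : ℕ → Submodule ℂ V) :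
    Set (V ≃ₗ[ℂ] V) :=
  {g | (∀ x y, b (g x) (g y) = b x y) ∧ LinearMap.det (g : V →ₗ[ℂ] V) = 1 ∧
    ∀ p ≤ N, (F p).map (g : V →ₗ[ℂ] V) = F p}

/-- The Plücker coordinates of an `m`-tuple of vectors: the maximal minors of its coordinate
matrix. Columns are listed by an arbitrary sequence `I`; reordering `I` changes the minor by a
sign and a repetition gives `0`, so these are the usual coordinates up to redundancy. -/
def plucker {N m : ℕ} (e : Module.Basis (Idx N) ℂ V) (v : Fin m → V) (I : Fin m → Idx N) : ℂ :=
  Matrix.det (Matrix.of fun r s : Fin m => e.repr (v r) (I s))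

/-- The polynomial `f` in the Plücker coordinates vanishes at the point `S` of the Grassmannian
of `m`-dimensional subspaces. Two bases of `S` have proportional Plücker coordinates, so for
homogeneous `f` it does not matter which basis of `S` is used. -/
def VanishesAt {N m : ℕ} (e : Module.Basis (Idx N) ℂ V)
    (f : MvPolynomial (Fin m → Idx N) ℂ) (S : Submodule ℂ V) : Prop :=
  ∀ v : Fin m → V, LinearIndependent ℂ v → Submodule.span ℂ (Set.range v) = S →
    MvPolynomial.eval (plucker e v) f = 0

/-- The Zariski closure of a subset of `OG(m, N)` as a subvariety of projective space under the
Plücker embedding: all points at which every homogeneous polynomial that vanishes on `A`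
vanishes. -/
def zariskiClosure {N : ℕ} (b : LinearMap.BilinForm ℂ V) (m : ℕ)
    (e : Module.Basis (Idx N) ℂ V) (A : Set (Submodule ℂ V)) : Set (Submodule ℂ V) :=
  {S | S ∈ OG b m ∧ ∀ (d : ℕ) (f : MvPolynomial (Fin m → Idx N) ℂ), f.IsHomogeneous d →
    (∀ T ∈ A, VanishesAt e f T) → VanishesAt e f S}

variable {n m : ℕ}

/-- The coordinate subspace `⟨e_p : p ∈ P⟩`. -/
def coordSubspace (e : Module.Basis (Idx (2 * n + 2)) ℂ V) (P : IndexSet n m) :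
    Submodule ℂ V :=
  Submodule.span ℂ (e '' {i | (i : ℕ) ∈ P.carrier})

/-- The Schubert cell: the orbit of `⟨e_p : p ∈ P⟩` under the Borel subgroup. -/
def schubertCell (b : LinearMap.BilinForm ℂ V) (F : ℕ → Submodule ℂ V)
    (e : Module.Basis (Idx (2 * n + 2)) ℂ V) (P : IndexSet n m) : Set (Submodule ℂ V) :=
  {S | ∃ g ∈ borel b (2 * n + 2) F, S = (coordSubspace e P).map (g : V →ₗ[ℂ] V)}

/-- The Schubert variety `X_P`: the Zariski closure of the Schubert cell. -/
def schubertVariety (b : LinearMap.BilinForm ℂ V) (F : ℕ → Submodule ℂ V)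
    (e : Module.Basis (Idx (2 * n + 2)) ℂ V) (P : IndexSet n m) : Set (Submodule ℂ V) :=
  zariskiClosure b m e (schubertCell b F e P)

/-- The set `Y_P` defined by the dimension inequalities. -/
def schubertY (b : LinearMap.BilinForm ℂ V) (F : ℕ → Submodule ℂ V) (P : IndexSet n m) :
    Set (Submodule ℂ V) :=
  {S | S ∈ OG b m ∧
    ∀ j : Fin m, (j : ℕ) + 1 ≤ Module.finrank ℂ (S ⊓ F (P.barElt j) : Submodule ℂ V)}

/-- The parity conditions on `S`: for all `c` with `[c, n+1] ⊆ [P]`, either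
`dim (S ∩ F_{c-1}) > #(P ∩ [1, c-1])` or
`dim ((S + F_{c-1}) ∩ F_{n+1}) ≡ c - 1 + #(P ∩ [c, n+1])` modulo `2`. -/
def ParityConditions (F : ℕ → Submodule ℂ V) (P : IndexSet n m) (S : Submodule ℂ V) : Prop :=
  ∀ c : ℕ, 1 ≤ c → c ≤ n + 1 → Finset.Icc c (n + 1) ⊆ P.sym →
    P.count 1 (c - 1) < Module.finrank ℂ (S ⊓ F (c - 1) : Submodule ℂ V) ∨
    Module.finrank ℂ ((S ⊔ F (c - 1)) ⊓ F (n + 1) : Submodule ℂ V) ≡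
      c - 1 + P.count c (n + 1) [MOD 2]

end EvenOG

end

/-! The Borel subgroup has one orbit on `OG(m, N)` for every index set, so each assertion only has
to be tested on the cells, and everything reduces to showing that the cell of `Q` lies in `X_P` if
and only if `Q ⪯ P`.

If `Q ⪯ P`, then `Q` is reached from `P` by elementary moves, each of which lowers an element `p`
to some `q`, and replaces `N + 1 - q` by `N + 1 - p` if necessary. A one-parameter root subgroup
carries `⟨e_r : r ∈ R⟩` for the moved index set `R` into the cell of `P` at all nonzero parameters,
so the cell of `R` lies in the closure of that of `P`.

Conversely, the Plücker coordinate indexed by `Q` vanishes nowhere on the cell of `Q`. If that cell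
meets `X_P`, some `S` in the cell of `P` is therefore disjoint from `⟨e_i : i ∉ Q⟩`. Intersecting
with the flag yields `Q ≤ P`. At a critical `c`, the space `(S + F_{c-1}) ∩ F_{c-1}^⊥` is a maximal
isotropic subspace disjoint from the coordinate complement of the corresponding space for `Q`; an
isometry that moves one of these two families of maximal isotropic subspaces to the other has
determinant `-1`, which forces the types to agree. -/

noncomputable section

namespace EvenOG

namespace IndexSet

variable {n m : ℕ}

lemma mem_bounds (P : IndexSet n m) {x : ℕ} (hx : x ∈ P.carrier) : 1 ≤ x ∧ x ≤ 2 * n + 2 :=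
  Finset.mem_Icc.1 (P.subset_Icc hx)

lemma dual_notMem (P : IndexSet n m) {x : ℕ} (hx : x ∈ P.carrier) :
    2 * n + 3 - x ∉ P.carrier := by
  intro h
  have := P.mem_bounds hx
  exact P.add_ne _ hx _ h (by omega)

lemma succ_middle_notMem (P : IndexSet n m) (h : n + 1 ∈ P.carrier) : n + 2 ∉ P.carrier :=
  fun h' => P.add_ne _ h _ h' (by omega)

lemma mem_sym (P : IndexSet n m) {x : ℕ} (h1 : 1 ≤ x) (h2 : x ≤ 2 * n + 2) :
    x ∈ P.sym ↔ x ∈ P.carrier ∨ 2 * n + 3 - x ∈ P.carrier := by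
  simp only [sym, Finset.mem_union, Finset.mem_image]
  refine or_congr_right ⟨?_, fun h => ⟨_, h, by omega⟩⟩
  rintro ⟨y, hy, rfl⟩
  have := P.mem_bounds hy
  rwa [show 2 * n + 3 - (2 * n + 3 - y) = y by omega]

/-- The rank function `k ↦ #(P ∩ [1, k])` of an index set: its value at `k` is the dimension of
the intersection of `⟨e_p : p ∈ P⟩` with `F_k`. All conditions on index sets are expressed
through it. -/
def rank (P : IndexSet n m) (k : ℕ) : ℕ := P.count 1 k

lemma rank_zero (P : IndexSet n m) : P.rank 0 = 0 := by
  simp [rank, count]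

lemma rank_succ (P : IndexSet n m) (k : ℕ) :
    P.rank (k + 1) = P.rank k + if k + 1 ∈ P.carrier then 1 else 0 := by
  unfold rank count
  rw [← Finset.insert_Icc_right_eq_Icc_add_one (show 1 ≤ k + 1 by omega)]
  split_ifs with hk
  · rw [Finset.inter_insert_of_mem hk, Finset.card_insert_of_notMem (by simp)]
  · rw [Finset.inter_insert_of_notMem hk, add_zero]

lemma rank_eq_rank_pred_add (P : IndexSet n m) {k : ℕ} (hk : 1 ≤ k) :
    P.rank k = P.rank (k - 1) + if k ∈ P.carrier then 1 else 0 := by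
  obtain ⟨k, rfl⟩ := Nat.exists_eq_add_of_le' hk
  exact P.rank_succ k

lemma rank_mono (P : IndexSet n m) : Monotone P.rank :=
  monotone_nat_of_le_succ fun k => (Nat.le_add_right _ _).trans_eq (P.rank_succ k).symm

lemma rank_le (P : IndexSet n m) (k : ℕ) : P.rank k ≤ m :=
  (Finset.card_le_card Finset.inter_subset_left).trans_eq P.card_eq

lemma rank_of_le (P : IndexSet n m) {k : ℕ} (hk : 2 * n + 2 ≤ k) : P.rank k = m := by
  unfold rank count
  rw [Finset.inter_eq_left.2 (P.subset_Icc.trans (Finset.Icc_subset_Icc_right hk)), P.card_eq]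

lemma rank_add_count (P : IndexSet n m) {c d : ℕ} (h1 : 1 ≤ c) (hcd : c ≤ d + 1) :
    P.rank (c - 1) + P.count c d = P.rank d := by
  unfold rank count
  rw [← Finset.card_union_of_disjoint, ← Finset.inter_union_distrib_left]
  · congr 2
    ext x
    simp only [Finset.mem_union, Finset.mem_Icc]
    omega
  · refine Finset.disjoint_left.2 fun x hx hy => ?_
    simp only [Finset.mem_inter, Finset.mem_Icc] at hx hy
    omega

lemma rank_le_rank_add (P : IndexSet n m) {a b : ℕ} (hab : a ≤ b) :
    P.rank b ≤ P.rank a + (b - a) := by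
  induction b, hab using Nat.le_induction with
  | base => simp
  | succ b hab ih =>
    rw [rank_succ]
    split_ifs <;> omega

lemma rank_eq_of_forall_notMem (P : IndexSet n m) {a b : ℕ} (hab : a ≤ b)
    (h : ∀ x, a < x → x ≤ b → x ∉ P.carrier) : P.rank b = P.rank a := by
  induction b, hab using Nat.le_induction with
  | base => rfl
  | succ b hab ih =>
    rw [rank_succ, if_neg (h _ (by omega) le_rfl), add_zero]
    exact ih fun x h1 h2 => h x h1 (by omega)

lemma rank_eq_of_forall_mem (P : IndexSet n m) {a b : ℕ} (hab : a ≤ b)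
    (h : ∀ x, a < x → x ≤ b → x ∈ P.carrier) : P.rank b = P.rank a + (b - a) := by
  induction b, hab using Nat.le_induction with
  | base => simp
  | succ b hab ih =>
    rw [rank_succ, if_pos (h _ (by omega) le_rfl), ih fun x h1 h2 => h x h1 (by omega)]
    omega

/-- Folding the interval `[c, N + 1 - c]` at its centre maps its elements of `P` injectively onto
the elements of `[P]` in its lower half. -/
lemma rank_dual (P : IndexSet n m) {c : ℕ} (hc1 : 1 ≤ c) (hc : c ≤ n + 2) :
    P.rank (2 * n + 3 - c) = P.rank (c - 1) + (Finset.Icc c (n + 1) ∩ P.sym).card := by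
  rw [← P.rank_add_count hc1 (show c ≤ 2 * n + 3 - c + 1 by omega), add_right_inj]
  refine Finset.card_bij (fun x _ => min x (2 * n + 3 - x)) ?_ ?_ ?_
  · intro x hx
    simp only [Finset.mem_inter, Finset.mem_Icc] at hx ⊢
    have hx2 : 2 * n + 3 - (2 * n + 3 - x) = x := by omega
    refine ⟨by omega, (P.mem_sym (by omega) (by omega)).2 ?_⟩
    rcases min_choice x (2 * n + 3 - x) with h | h <;> rw [h]
    · exact Or.inl hx.1
    · exact Or.inr (hx2.symm ▸ hx.1)
  · intro x hx y hy hxy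
    simp only [Finset.mem_inter, Finset.mem_Icc] at hx hy
    have := P.add_ne x hx.1 y hy.1
    omega
  · intro y hy
    simp only [Finset.mem_inter, Finset.mem_Icc] at hy
    rcases (P.mem_sym (by omega) (by omega)).1 hy.2 with h | h
    · exact ⟨y, by simp only [Finset.mem_inter, Finset.mem_Icc]; exact ⟨h, by omega⟩, by omega⟩
    · exact ⟨2 * n + 3 - y, by simp only [Finset.mem_inter, Finset.mem_Icc]; exact ⟨h, by omega⟩,
        by omega⟩

lemma rank_dual_le (P : IndexSet n m) {c : ℕ} (hc1 : 1 ≤ c) (hc : c ≤ n + 2) :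
    P.rank (2 * n + 3 - c) ≤ P.rank (c - 1) + (n + 2 - c) := by
  rw [P.rank_dual hc1 hc]
  have := Finset.card_le_card (Finset.inter_subset_left (s₁ := Finset.Icc c (n + 1)) (s₂ := P.sym))
  rw [Nat.card_Icc] at this
  omega

lemma rank_dual_eq_iff (P : IndexSet n m) {c : ℕ} (hc1 : 1 ≤ c) (hc : c ≤ n + 2) :
    P.rank (2 * n + 3 - c) = P.rank (c - 1) + (n + 2 - c) ↔ Finset.Icc c (n + 1) ⊆ P.sym := by
  rw [P.rank_dual hc1 hc, add_right_inj, ← Finset.inter_eq_left]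
  have hcard : (Finset.Icc c (n + 1)).card = n + 2 - c := by rw [Nat.card_Icc]
  rw [← hcard]
  exact ⟨Finset.eq_of_subset_of_card_le Finset.inter_subset_left ∘ ge_of_eq, congrArg _⟩

lemma elt_mem (P : IndexSet n m) (j : Fin m) : P.elt j ∈ P.carrier :=
  Finset.orderEmbOfFin_mem _ _ _

lemma exists_elt_eq (P : IndexSet n m) {x : ℕ} (hx : x ∈ P.carrier) : ∃ j, P.elt j = x := by
  have hx' : x ∈ Set.range (P.carrier.orderEmbOfFin P.card_eq) := by
    rwa [Finset.range_orderEmbOfFin]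
  exact hx'

lemma ext_elt {P Q : IndexSet n m} (h : ∀ j, P.elt j = Q.elt j) : P = Q := by
  ext x
  constructor <;> intro hx
  · obtain ⟨j, rfl⟩ := P.exists_elt_eq hx
    exact h j ▸ Q.elt_mem j
  · obtain ⟨j, rfl⟩ := Q.exists_elt_eq hx
    exact h j ▸ P.elt_mem j

lemma elt_le_iff (P : IndexSet n m) (j : Fin m) (k : ℕ) : P.elt j ≤ k ↔ (j : ℕ) < P.rank k := by
  have hmono : ∀ i i', P.elt i ≤ P.elt i' ↔ i ≤ i' := fun i i' =>
    (P.carrier.orderEmbOfFin P.card_eq).le_iff_le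
  have himage : ∀ s : Finset (Fin m), (s.image P.elt).card = s.card := fun s =>
    Finset.card_image_of_injective _ (P.carrier.orderEmbOfFin P.card_eq).injective
  constructor
  · intro h
    have hsub : (Finset.Iic j).image P.elt ⊆ P.carrier ∩ Finset.Icc 1 k := by
      intro x hx
      obtain ⟨i, hi, rfl⟩ := Finset.mem_image.1 hx
      exact Finset.mem_inter.2 ⟨P.elt_mem i, Finset.mem_Icc.2 ⟨(P.mem_bounds (P.elt_mem i)).1,
        ((hmono i j).2 (Finset.mem_Iic.1 hi)).trans h⟩⟩
    have hcard := Finset.card_le_card hsub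
    rwa [himage, Fin.card_Iic] at hcard
  · contrapose!
    intro hk
    have hsub : P.carrier ∩ Finset.Icc 1 k ⊆ (Finset.Iio j).image P.elt := by
      intro x hx
      obtain ⟨hxP, hxk⟩ := Finset.mem_inter.1 hx
      obtain ⟨i, rfl⟩ := P.exists_elt_eq hxP
      refine Finset.mem_image_of_mem _ (Finset.mem_Iio.2 (not_le.1 fun hji => ?_))
      have := (hmono j i).2 hji
      have := (Finset.mem_Icc.1 hxk).2
      omega
    have hcard := Finset.card_le_card hsub
    rwa [himage, Fin.card_Iio] at hcard

lemma le_iff_rank_le {P Q : IndexSet n m} : Q.Le P ↔ ∀ k, P.rank k ≤ Q.rank k := by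
  constructor
  · intro h k
    by_contra! hk
    have hj : Q.rank k < m := hk.trans_le (P.rank_le k)
    have h1 := (P.elt_le_iff ⟨_, hj⟩ k).2 hk
    exact lt_irrefl _ ((Q.elt_le_iff ⟨_, hj⟩ k).1 ((h _).trans h1))
  · intro h j
    rw [elt_le_iff]
    exact ((P.elt_le_iff j _).1 le_rfl).trans_le (h _)

lemma Le.antisymm {P Q : IndexSet n m} (h : Q.Le P) (h' : P.Le Q) : Q = P :=
  ext_elt fun j => (h j).antisymm (h' j)

lemma barElt_le (P : IndexSet n m) (j : Fin m) : P.barElt j ≤ 2 * n + 2 := by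
  have := P.mem_bounds (P.elt_mem j)
  unfold barElt
  split_ifs <;> omega

lemma lt_rank_barElt_iff {P Q : IndexSet n m} :
    (∀ j : Fin m, (j : ℕ) < Q.rank (P.barElt j)) ↔ ∀ k ≠ n + 1, P.rank k ≤ Q.rank k := by
  constructor
  · intro h k hk1
    by_contra! hk
    have hj : Q.rank k < m := hk.trans_le (P.rank_le k)
    have helt := (P.elt_le_iff ⟨_, hj⟩ k).2 hk
    have hbar : P.barElt ⟨_, hj⟩ ≤ k := by
      unfold barElt
      split_ifs <;> omega
    exact ((h ⟨_, hj⟩).trans_le (Q.rank_mono hbar)).ne rfl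
  · intro h j
    have helt := (P.elt_le_iff j _).1 le_rfl
    unfold barElt
    split_ifs with hj
    · rw [hj] at helt
      exact (helt.trans_le (P.rank_mono (show n + 1 ≤ n + 2 by omega))).trans_le
        (h (n + 2) (by omega))
    · exact helt.trans_le (h _ hj)

lemma type_eq_zero_iff {P : IndexSet n m} :
    P.type = 0 ↔ n + 1 ∉ P.carrier ∧ n + 2 ∉ P.carrier := by
  have : P.carrier ∩ {n + 1, n + 2} = ∅ ↔ n + 1 ∉ P.carrier ∧ n + 2 ∉ P.carrier := by
    rw [← Finset.disjoint_iff_inter_eq_empty]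
    simp
  unfold type
  rw [← this]
  split_ifs with h <;> simp [h]

lemma type_ne_zero_iff {P : IndexSet n m} : P.type ≠ 0 ↔ n + 1 ∈ P.sym := by
  rw [P.mem_sym (by omega) (by omega), show 2 * n + 3 - (n + 1) = n + 2 by omega, Ne,
    type_eq_zero_iff]
  tauto

lemma type_of_ne_zero {P : IndexSet n m} (h : P.type ≠ 0) :
    P.type = 1 + (n + 1 - P.rank (n + 1)) % 2 := by
  unfold type at h ⊢
  rw [if_neg (by intro h'; simp [h'] at h), Finset.card_sdiff]
  simp [rank, count]

lemma type_eq_iff_rank_modEq {P Q : IndexSet n m} (hP : P.type ≠ 0) (hQ : Q.type ≠ 0) :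
    Q.type = P.type ↔ Q.rank (n + 1) ≡ P.rank (n + 1) [MOD 2] := by
  rw [type_of_ne_zero hP, type_of_ne_zero hQ]
  have h1 := P.rank_le_rank_add (Nat.zero_le (n + 1))
  have h2 := Q.rank_le_rank_add (Nat.zero_le (n + 1))
  rw [rank_zero] at h1 h2
  unfold Nat.ModEq
  omega

lemma critical_iff {P Q : IndexSet n m} : Q.Critical P ↔ ∃ c, 1 ≤ c ∧ c ≤ n + 1 ∧
    Finset.Icc c (n + 1) ⊆ P.sym ∧ Finset.Icc c (n + 1) ⊆ Q.sym ∧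
      Q.rank (c - 1) = P.rank (c - 1) := by
  simp only [Critical, Finset.subset_inter_iff, and_assoc, rank]

lemma Critical.type_ne_zero {P Q : IndexSet n m} (h : Q.Critical P) :
    Q.type ≠ 0 ∧ P.type ≠ 0 := by
  obtain ⟨c, _, hc, hP, hQ, _⟩ := critical_iff.1 h
  have hmem : n + 1 ∈ Finset.Icc c (n + 1) := Finset.right_mem_Icc.2 hc
  exact ⟨type_ne_zero_iff.2 (hQ hmem), type_ne_zero_iff.2 (hP hmem)⟩

lemma prec_of_type_eq_zero {P Q : IndexSet n m} (hle : Q.Le P) (h : Q.type = 0 ∨ P.type = 0) :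
    Q.Prec P :=
  ⟨hle, fun hc => (h.elim hc.type_ne_zero.1 hc.type_ne_zero.2).elim⟩

lemma Prec.rank_modEq {P Q : IndexSet n m} (h : Q.Prec P) {c : ℕ} (hc1 : 1 ≤ c)
    (hc : c ≤ n + 1) (hP : Finset.Icc c (n + 1) ⊆ P.sym) (hrank : Q.rank (c - 1) = P.rank (c - 1)) :
    Q.rank (n + 1) ≡ P.rank (n + 1) [MOD 2] := by
  have hQ : Finset.Icc c (n + 1) ⊆ Q.sym := by
    have hP' := (P.rank_dual_eq_iff hc1 (by omega)).2 hP
    have hle := le_iff_rank_le.1 h.1 (2 * n + 3 - c)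
    rw [← Q.rank_dual_eq_iff hc1 (by omega)]
    exact (Q.rank_dual_le hc1 (by omega)).antisymm (by omega)
  have hcrit : Q.Critical P := critical_iff.2 ⟨c, hc1, hc, hP, hQ, hrank⟩
  exact (type_eq_iff_rank_modEq hcrit.type_ne_zero.2 hcrit.type_ne_zero.1).1 (h.2 hcrit)

lemma prec_iff_parity {P Q : IndexSet n m} :
    Q.Prec P ↔ (∀ k ≠ n + 1, P.rank k ≤ Q.rank k) ∧
      ∀ c, 1 ≤ c → c ≤ n + 1 → Finset.Icc c (n + 1) ⊆ P.sym →
        P.rank (c - 1) < Q.rank (c - 1) ∨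
        Q.count c (n + 1) ≡ P.count c (n + 1) [MOD 2] := by
  constructor
  · intro h
    have hle := le_iff_rank_le.1 h.1
    refine ⟨fun k _ => hle k, fun c hc1 hc hP => (hle (c - 1)).lt_or_eq.imp_right fun heq => ?_⟩
    have hmod := h.rank_modEq hc1 hc hP heq.symm
    rw [← P.rank_add_count hc1 (show c ≤ n + 1 + 1 by omega),
      ← Q.rank_add_count hc1 (show c ≤ n + 1 + 1 by omega), heq] at hmod
    exact hmod.add_left_cancel'
  · rintro ⟨hle, hparity⟩
    refine ⟨le_iff_rank_le.2 fun k => ?_, fun hcrit => ?_⟩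
    · rcases ne_or_eq k (n + 1) with hk | rfl
      · exact hle k hk
      have hn := hle n (by omega)
      have hQ := Q.rank_mono (show n ≤ n + 1 by omega)
      have hP := P.rank_succ n
      by_cases hmem : n + 1 ∈ P.carrier
      · have hpar := hparity (n + 1) (by omega) le_rfl (by
          rw [Finset.Icc_self, Finset.singleton_subset_iff, P.mem_sym (by omega) (by omega)]
          exact Or.inl hmem)
        have hPc := P.rank_add_count (show 1 ≤ n + 1 by omega) (show n + 1 ≤ n + 1 + 1 by omega)
        have hQc := Q.rank_add_count (show 1 ≤ n + 1 by omega) (show n + 1 ≤ n + 1 + 1 by omega)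
        rw [if_pos hmem] at hP
        rw [add_tsub_cancel_right] at hpar hPc hQc
        unfold Nat.ModEq at hpar
        omega
      · rw [if_neg hmem] at hP
        omega
    · rw [type_eq_iff_rank_modEq hcrit.type_ne_zero.2 hcrit.type_ne_zero.1]
      obtain ⟨c, hc1, hc, hP, -, hrank⟩ := critical_iff.1 hcrit
      rw [← P.rank_add_count hc1 (show c ≤ n + 1 + 1 by omega),
        ← Q.rank_add_count hc1 (show c ≤ n + 1 + 1 by omega), hrank]
      exact ((hparity c hc1 hc hP).resolve_left hrank.not_gt).add_left _

lemma prec_iff_of_type_eq_zero {P Q : IndexSet n m} (hP : P.type = 0) :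
    Q.Prec P ↔ ∀ k ≠ n + 1, P.rank k ≤ Q.rank k := by
  rw [prec_iff_parity, and_iff_left]
  intro c _ hc hsym
  exact absurd hP (type_ne_zero_iff.2 (hsym (Finset.right_mem_Icc.2 hc)))

lemma mem_iota (P : IndexSet n m) {x : ℕ} :
    x ∈ P.iota.carrier ↔ Equiv.swap (n + 1) (n + 2) x ∈ P.carrier := by
  constructor
  · intro h
    obtain ⟨p, hp, rfl⟩ := Finset.mem_image.1 h
    rwa [Equiv.swap_apply_self]
  · exact fun h => Finset.mem_image.2 ⟨_, h, Equiv.swap_apply_self _ _ _⟩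

lemma mem_iota_left (P : IndexSet n m) : n + 1 ∈ P.iota.carrier ↔ n + 2 ∈ P.carrier := by
  rw [mem_iota, Equiv.swap_apply_left]

lemma mem_iota_right (P : IndexSet n m) : n + 2 ∈ P.iota.carrier ↔ n + 1 ∈ P.carrier := by
  rw [mem_iota, Equiv.swap_apply_right]

lemma type_iota_ne_zero {P : IndexSet n m} (hP : P.type ≠ 0) : P.iota.type ≠ 0 := by
  rw [Ne, type_eq_zero_iff, mem_iota_left, mem_iota_right, and_comm, ← type_eq_zero_iff]
  exact hP

lemma rank_iota (P : IndexSet n m) {k : ℕ} (hk : k ≠ n + 1) : P.iota.rank k = P.rank k := by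
  have himage : P.iota.carrier ∩ Finset.Icc 1 k =
      (P.carrier ∩ Finset.Icc 1 k).image (Equiv.swap (n + 1) (n + 2)) := by
    have hIcc : (Finset.Icc 1 k).image (Equiv.swap (n + 1) (n + 2)) = Finset.Icc 1 k := by
      refine Finset.eq_of_subset_of_card_le (Finset.image_subset_iff.2 fun x hx => ?_)
        (Finset.card_image_of_injective _ (Equiv.injective _)).ge
      rw [Finset.mem_Icc] at hx ⊢
      rw [Equiv.swap_apply_def]
      split_ifs <;> omega
    rw [Finset.image_inter _ _ (Equiv.injective _), hIcc]
    rfl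
  unfold rank count
  rw [himage, Finset.card_image_of_injective _ (Equiv.injective _)]

lemma rank_iota_middle {P : IndexSet n m} (hP : P.type ≠ 0) :
    P.iota.rank (n + 1) + P.rank (n + 1) = 2 * P.rank n + 1 := by
  have hnot := P.succ_middle_notMem
  rw [Ne, type_eq_zero_iff] at hP
  rw [rank_succ, rank_succ, P.rank_iota (by omega)]
  simp only [mem_iota_left]
  split_ifs <;> first | omega | tauto

lemma prec_or_prec_iota {P Q : IndexSet n m} (hP : P.type ≠ 0)
    (h : ∀ k ≠ n + 1, P.rank k ≤ Q.rank k) : Q.Prec P ∨ Q.Prec P.iota := by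
  have hPs := P.rank_succ n
  have hQs := Q.rank_succ n
  have hn := h n (by omega)
  have hsum := rank_iota_middle hP
  have le_of_middle (hmid : P.rank (n + 1) ≤ Q.rank (n + 1)) : Q.Le P :=
    le_iff_rank_le.2 fun k => if hk : k = n + 1 then hk ▸ hmid else h k hk
  have le_iota_of_middle (hmid : P.iota.rank (n + 1) ≤ Q.rank (n + 1)) : Q.Le P.iota :=
    le_iff_rank_le.2 fun k =>
      if hk : k = n + 1 then hk ▸ hmid else (P.rank_iota hk).trans_le (h k hk)
  by_cases hQ : Q.type = 0
  · by_cases hmem : n + 1 ∈ P.carrier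
    · rw [if_pos hmem] at hPs
      exact Or.inr (prec_of_type_eq_zero (le_iota_of_middle (by omega)) (Or.inl hQ))
    · rw [if_neg hmem] at hPs
      exact Or.inl (prec_of_type_eq_zero (le_of_middle (by omega)) (Or.inl hQ))
  · have htype := type_eq_iff_rank_modEq hP hQ
    have htype_iota := type_eq_iff_rank_modEq (type_iota_ne_zero hP) hQ
    unfold Nat.ModEq at htype htype_iota
    by_cases hmod : P.rank (n + 1) ≤ Q.rank (n + 1) ∧ Q.rank (n + 1) % 2 = P.rank (n + 1) % 2
    · exact Or.inl ⟨le_of_middle hmod.1, fun _ => htype.2 hmod.2⟩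
    · split_ifs at hPs hQs <;>
        exact Or.inr ⟨le_iota_of_middle (by omega), fun _ => htype_iota.2 (by omega)⟩

lemma prec_or_prec_iota_iff {P Q : IndexSet n m} (hP : P.type ≠ 0) :
    Q.Prec P ∨ Q.Prec P.iota ↔ ∀ k ≠ n + 1, P.rank k ≤ Q.rank k := by
  refine ⟨?_, prec_or_prec_iota hP⟩
  rintro (h | h) k hk
  · exact le_iff_rank_le.1 h.1 k
  · exact (P.rank_iota hk).symm.trans_le (le_iff_rank_le.1 h.1 k)

/-- The permutation of `[1, N]` that exchanges `p` with `q` and `N + 1 - p` with `N + 1 - q`,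
a reflection in the Weyl group of `SO(V)` when `p + q ≠ N + 1`. -/
def reflection (n p q : ℕ) : Equiv.Perm ℕ :=
  Equiv.swap p q * Equiv.swap (2 * n + 3 - p) (2 * n + 3 - q)

lemma reflection_apply {p q : ℕ} (hq : 1 ≤ q) (hqp : q < p) (hp : p ≤ 2 * n + 2)
    (hadd : p + q ≠ 2 * n + 3) (x : ℕ) :
    reflection n p q x = if x = p then q else if x = q then p
      else if x = 2 * n + 3 - p then 2 * n + 3 - q
      else if x = 2 * n + 3 - q then 2 * n + 3 - p else x := by
  rw [reflection, Equiv.Perm.mul_apply, Equiv.swap_apply_def (2 * n + 3 - p),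
    Equiv.swap_apply_def p]
  split_ifs <;> omega

lemma reflection_reflection {p q : ℕ} (hq : 1 ≤ q) (hqp : q < p) (hp : p ≤ 2 * n + 2)
    (hadd : p + q ≠ 2 * n + 3) (x : ℕ) : reflection n p q (reflection n p q x) = x := by
  simp only [reflection_apply hq hqp hp hadd]
  split_ifs <;> omega

/-- The index set `R` arises from `P` by lowering the element `p` to `q`, together with the move
of `N + 1 - q` to `N + 1 - p` in case `N + 1 - q ∈ P`. -/
structure IsLowering (p q : ℕ) (P R : IndexSet n m) : Prop where
  one_le : 1 ≤ q
  lt : q < p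
  add_ne : p + q ≠ 2 * n + 3
  mem : p ∈ P.carrier
  notMem : q ∉ P.carrier
  mem_iff : ∀ x, x ∈ R.carrier ↔ reflection n p q x ∈ P.carrier

/-- An elementary move: `R` arises from `P` by lowering some element. -/
def Move (P R : IndexSet n m) : Prop := ∃ p q, IsLowering p q P R

lemma exists_mem_iff_reflection (P : IndexSet n m) {p q : ℕ} (hq : 1 ≤ q) (hqp : q < p)
    (hp : p ≤ 2 * n + 2) (hadd : p + q ≠ 2 * n + 3) :
    ∃ R : IndexSet n m, ∀ x, x ∈ R.carrier ↔ reflection n p q x ∈ P.carrier := by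
  have hrefl := reflection_apply hq hqp hp hadd
  refine ⟨⟨P.carrier.image (reflection n p q), ?_, ?_, ?_⟩, fun x => ?_⟩
  · refine Finset.image_subset_iff.2 fun x hx => Finset.mem_Icc.2 ?_
    have := P.mem_bounds hx
    rw [hrefl]
    split_ifs <;> omega
  · rw [Finset.card_image_of_injective _ (Equiv.injective _), P.card_eq]
  · simp only [Finset.forall_mem_image]
    intro x hx y hy
    have := P.add_ne x hx y hy
    rw [hrefl, hrefl]
    split_ifs <;> omega
  · rw [Finset.mem_image]
    constructor
    · rintro ⟨y, hy, rfl⟩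
      rwa [reflection_reflection hq hqp hp hadd]
    · exact fun h => ⟨_, h, reflection_reflection hq hqp hp hadd x⟩

lemma exists_isLowering (P : IndexSet n m) {p q : ℕ} (hq : 1 ≤ q) (hqp : q < p)
    (hadd : p + q ≠ 2 * n + 3) (hp : p ∈ P.carrier) (hqP : q ∉ P.carrier) :
    ∃ R, IsLowering p q P R := by
  obtain ⟨R, hR⟩ := P.exists_mem_iff_reflection hq hqp (P.mem_bounds hp).2 hadd
  exact ⟨R, hq, hqp, hadd, hp, hqP, hR⟩

lemma exists_isLowering_to (R : IndexSet n m) {p q : ℕ} (hqp : q < p) (hp : p ≤ 2 * n + 2)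
    (hadd : p + q ≠ 2 * n + 3) (hq : q ∈ R.carrier) (hpR : p ∉ R.carrier) :
    ∃ P, IsLowering p q P R := by
  have hq1 := (R.mem_bounds hq).1
  obtain ⟨P, hP⟩ := R.exists_mem_iff_reflection hq1 hqp hp hadd
  refine ⟨P, hq1, hqp, hadd, ?_, ?_, fun x => ?_⟩
  · rwa [hP, reflection_apply hq1 hqp hp hadd, if_pos rfl]
  · rwa [hP, reflection_apply hq1 hqp hp hadd, if_neg hqp.ne, if_pos rfl]
  · rw [hP, reflection_reflection hq1 hqp hp hadd]

namespace IsLowering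

variable {p q : ℕ} {P R : IndexSet n m}

lemma mem_iff_or (h : IsLowering p q P R) (x : ℕ) : x ∈ R.carrier ↔
    x = q ∨ (x = 2 * n + 3 - p ∧ 2 * n + 3 - q ∈ P.carrier) ∨
      (x ≠ p ∧ x ≠ 2 * n + 3 - q ∧ x ∈ P.carrier) := by
  have hp := P.mem_bounds h.mem
  have hp' := P.dual_notMem h.mem
  have := h.one_le
  have := h.lt
  have := h.add_ne
  have hmem := h.mem
  have hnot := h.notMem
  rw [h.mem_iff, reflection_apply h.one_le h.lt hp.2 h.add_ne]
  grind

lemma rank_add (h : IsLowering p q P R) (k : ℕ) :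
    R.rank k + (if p ≤ k then 1 else 0) +
        (if 2 * n + 3 - q ∈ P.carrier ∧ 2 * n + 3 - q ≤ k then 1 else 0) =
      P.rank k + (if q ≤ k then 1 else 0) +
        (if 2 * n + 3 - q ∈ P.carrier ∧ 2 * n + 3 - p ≤ k then 1 else 0) := by
  have hp := P.mem_bounds h.mem
  have hq := h.one_le
  have hqp := h.lt
  have hadd := h.add_ne
  have hmem := h.mem
  have hnot := h.notMem
  have hp' := P.dual_notMem hmem
  induction k with
  | zero => grind [rank_zero]
  | succ k ih =>
    have hR := h.mem_iff (k + 1)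
    rw [reflection_apply hq hqp hp.2 hadd] at hR
    rw [rank_succ, rank_succ]
    grind (splits := 20)

lemma rank_le (h : IsLowering p q P R) (k : ℕ) : P.rank k ≤ R.rank k := by
  have hk := h.rank_add k
  have := h.lt
  grind

lemma le (h : IsLowering p q P R) : R.Le P := le_iff_rank_le.2 h.rank_le

lemma mem_low (h : IsLowering p q P R) : q ∈ R.carrier := (h.mem_iff_or q).2 (Or.inl rfl)

lemma ne (h : IsLowering p q P R) : R ≠ P := by
  rintro rfl
  exact h.notMem h.mem_low

lemma rank_of_dual_notMem (h : IsLowering p q P R) (hq : 2 * n + 3 - q ∉ P.carrier) (k : ℕ) :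
    R.rank k = P.rank k + if q ≤ k ∧ k < p then 1 else 0 := by
  have hk := h.rank_add k
  have := h.lt
  simp only [hq, false_and, if_false, add_zero] at hk
  split_ifs at hk ⊢ <;> omega

lemma type_eq (h : IsLowering p q P R)
    (hpq : 2 * n + 3 - q ∈ P.carrier ∨ n + 1 ≤ q ∨ p ≤ n + 2) (hP : P.type ≠ 0)
    (hR : R.type ≠ 0) : R.type = P.type := by
  rw [type_eq_iff_rank_modEq hP hR]
  have hrank := h.rank_add (n + 1)
  have hp := P.mem_bounds h.mem
  have hq := h.one_le
  have hqp := h.lt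
  have hadd := h.add_ne
  have hnot := h.notMem
  rw [Ne, type_eq_zero_iff] at hP hR
  unfold Nat.ModEq
  by_cases hq' : 2 * n + 3 - q ∈ P.carrier
  · simp only [hq', true_and] at hrank
    split_ifs at hrank <;> omega
  have hq_ne : q ≠ n + 1 := by
    rintro rfl
    rw [show 2 * n + 3 - (n + 1) = n + 2 by omega] at hq'
    exact hP ⟨hnot, hq'⟩
  have hp_ne : p ≠ n + 2 := by
    rintro rfl
    refine hR ⟨fun hmem => ?_, fun hmem => ?_⟩ <;>
    · rcases (h.mem_iff_or _).1 hmem with _ | ⟨_, _⟩ | ⟨_, _, hmem'⟩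
      · omega
      · contradiction
      · first | omega | exact P.succ_middle_notMem hmem' h.mem
  simp only [hq', false_and, if_false, false_or] at hrank hpq
  split_ifs at hrank <;> omega

lemma type_eq_zero (h : IsLowering p q P R) (hp : p = n + 1 ∨ p = n + 2)
    (hq : q ≠ n + 1 ∧ q ≠ n + 2) (hq' : 2 * n + 3 - q ∉ P.carrier) : R.type = 0 := by
  have := P.dual_notMem h.mem
  have hmem := h.mem_iff_or
  rw [type_eq_zero_iff, hmem, hmem]
  simp only [hq', and_false, false_or]
  rcases hp with rfl | rfl
  · rw [show 2 * n + 3 - (n + 1) = n + 2 by omega] at this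
    exact ⟨by omega, by tauto⟩
  · rw [show 2 * n + 3 - (n + 2) = n + 1 by omega] at this
    exact ⟨by tauto, by omega⟩

lemma iota (h : IsLowering p q P R) (hP : P.type = 0) (hR : R.type ≠ 0) :
    IsLowering p (2 * n + 3 - q) P R.iota := by
  obtain ⟨hP1, hP2⟩ := type_eq_zero_iff.1 hP
  have hp := P.mem_bounds h.mem
  have hqp := h.lt
  have hadd := h.add_ne
  have hmem := h.mem_iff_or
  have hp1 : p ≠ n + 1 := by rintro rfl; exact hP1 h.mem
  have hp2 : p ≠ n + 2 := by rintro rfl; exact hP2 h.mem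
  have hq : q = n + 1 ∨ q = n + 2 := by
    by_contra! hq
    refine hR (type_eq_zero_iff.2 ⟨fun hx => ?_, fun hx => ?_⟩) <;>
    · rcases (hmem _).1 hx with _ | ⟨_, _⟩ | ⟨_, _, _⟩
      · omega
      · omega
      · contradiction
  have hq' : 2 * n + 3 - q ∉ P.carrier := by
    rcases hq with rfl | rfl
    · rwa [show 2 * n + 3 - (n + 1) = n + 2 by omega]
    · rwa [show 2 * n + 3 - (n + 2) = n + 1 by omega]
  refine ⟨by omega, by omega, by omega, h.mem, hq', fun x => ?_⟩
  have hp' := P.dual_notMem h.mem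
  rw [mem_iota, h.mem_iff, reflection_apply h.one_le hqp hp.2 hadd,
    reflection_apply (by omega) (by omega) hp.2 (by omega)]
  have hpm := h.mem
  have hqm := h.notMem
  rw [Equiv.swap_apply_def, show 2 * n + 3 - (2 * n + 3 - q) = q by omega]
  split_ifs <;> first | omega | simp only [hp', hqm, hpm, hq']

end IsLowering

lemma Move.le {P R : IndexSet n m} : Move P R → R.Le P := fun ⟨_, _, h⟩ => h.le

lemma Move.ne {P R : IndexSet n m} : Move P R → R ≠ P := fun ⟨_, _, h⟩ => h.ne

lemma Move.iota {P R : IndexSet n m} (h : Move P R) (hP : P.type = 0) (hR : R.type ≠ 0) :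
    Move P R.iota := by
  obtain ⟨p, q, h⟩ := h
  exact ⟨p, _, h.iota hP hR⟩

lemma exists_first_diff {P Q : IndexSet n m} (hle : Q.Le P) (hne : Q ≠ P) :
    ∃ q ∈ Q.carrier, q ∉ P.carrier ∧ P.rank q < Q.rank q ∧ ∀ k < q, Q.rank k = P.rank k := by
  classical
  rw [le_iff_rank_le] at hle
  have hex : ∃ k, P.rank k < Q.rank k := by
    by_contra! h
    exact hne (Le.antisymm (le_iff_rank_le.2 hle) (le_iff_rank_le.2 h))
  have hlt := Nat.find_spec hex
  have heq : ∀ k < Nat.find hex, Q.rank k = P.rank k := fun k hk =>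
    (not_lt.1 (Nat.find_min hex hk)).antisymm (hle k)
  have hpos : 1 ≤ Nat.find hex := by
    by_contra! h
    rw [Nat.lt_one_iff.1 h, rank_zero, rank_zero] at hlt
    exact lt_irrefl _ hlt
  have hP := P.rank_eq_rank_pred_add hpos
  have hQ := Q.rank_eq_rank_pred_add hpos
  have hpred := heq _ (Nat.sub_lt hpos one_pos)
  refine ⟨Nat.find hex, ?_, ?_, hlt, heq⟩
  · by_contra h
    rw [if_neg h] at hQ
    omega
  · intro h
    rw [if_pos h] at hP
    split_ifs at hQ <;> omega

lemma mem_iff_of_rank_eq {P Q : IndexSet n m} {q : ℕ} (h : ∀ k < q, Q.rank k = P.rank k) {x : ℕ}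
    (hx1 : 1 ≤ x) (hx : x < q) : x ∈ Q.carrier ↔ x ∈ P.carrier := by
  have hP := P.rank_eq_rank_pred_add hx1
  have hQ := Q.rank_eq_rank_pred_add hx1
  have h1 := h x hx
  have h2 := h (x - 1) (by omega)
  by_cases hxP : x ∈ P.carrier <;> by_cases hxQ : x ∈ Q.carrier <;>
    simp only [hxP, hxQ, if_true, if_false] at hP hQ ⊢ <;> omega

/-- The next element of `P` above `q` is lowered to `q`. -/
lemma exists_move_of_dual_notMem {P Q : IndexSet n m} (hle : Q.Le P) {q : ℕ}
    (hq : q ∈ Q.carrier) (hqP : q ∉ P.carrier) (hlt : P.rank q < Q.rank q)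
    (hq' : 2 * n + 3 - q ∉ P.carrier) :
    ∃ R, Move P R ∧ Q.Le R ∧ (P.type ≠ 0 → R.type ≠ 0 → R.type = P.type) := by
  classical
  have hqN := Q.mem_bounds hq
  have hex : ∃ p, q < p ∧ p ∈ P.carrier := by
    by_contra! h
    have h1 := P.rank_eq_of_forall_notMem hqN.2 fun x hx _ => h x hx
    have h2 := Q.rank_le q
    rw [P.rank_of_le le_rfl] at h1
    omega
  obtain ⟨hqp, hp⟩ := Nat.find_spec hex
  set p := Nat.find hex
  have hbetween : ∀ x, q < x → x < p → x ∉ P.carrier := fun x h1 h2 h3 =>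
    Nat.find_min hex h2 ⟨h1, h3⟩
  have hadd : p + q ≠ 2 * n + 3 := by
    intro h
    rw [show 2 * n + 3 - q = p by omega] at hq'
    exact hq' hp
  obtain ⟨R, hR⟩ := P.exists_isLowering hqN.1 hqp hadd hp hqP
  refine ⟨R, ⟨p, q, hR⟩, le_iff_rank_le.2 fun k => ?_, fun hPt hRt => hR.type_eq ?_ hPt hRt⟩
  · rw [hR.rank_of_dual_notMem hq']
    split_ifs with hk
    · have h1 := P.rank_eq_of_forall_notMem hk.1 fun x hx hxk => hbetween x hx (by omega)
      have h2 := Q.rank_mono hk.1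
      omega
    · exact le_iff_rank_le.1 hle k
  · by_contra! h
    refine hPt (type_eq_zero_iff.2 ⟨hbetween _ ?_ ?_, hbetween _ ?_ ?_⟩) <;> omega

lemma exists_last_notMem_below {P : IndexSet n m} {s : ℕ} (hs : n + 3 ≤ s) (hmem : s ∈ P.carrier) :
    ∃ r, n + 1 ≤ r ∧ r < s ∧ r ∉ P.carrier ∧ ∀ x, r < x → x ≤ s → x ∈ P.carrier := by
  classical
  have hfind {y : ℕ} (hy : n + 1 ≤ y) (hys : y ≤ s) (hyP : y ∉ P.carrier) :
      ∃ r, n + 1 ≤ r ∧ r < s ∧ r ∉ P.carrier ∧ ∀ x, r < x → x ≤ s → x ∈ P.carrier := by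
    have hspec := Nat.findGreatest_spec (P := (· ∉ P.carrier)) hys hyP
    refine ⟨Nat.findGreatest (· ∉ P.carrier) s, hy.trans (Nat.le_findGreatest hys hyP),
      (Nat.findGreatest_le s).lt_of_ne fun h => hspec (h.symm ▸ hmem), hspec, fun x hx hxs => ?_⟩
    exact not_not.1 (Nat.findGreatest_is_greatest hx hxs)
  by_cases h : n + 1 ∈ P.carrier
  · exact hfind (by omega) (by omega) (P.succ_middle_notMem h)
  · exact hfind le_rfl (by omega) h

lemma rank_lt_rank_of_forall_mem {P Q : IndexSet n m} {r s : ℕ} (hle : P.rank s ≤ Q.rank s)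
    (hs : s ∉ Q.carrier) (hmem : ∀ x, r < x → x ≤ s → x ∈ P.carrier) {k : ℕ} (hrk : r ≤ k)
    (hks : k < s) : P.rank k < Q.rank k := by
  have hP := P.rank_eq_of_forall_mem hks.le fun x hx hxs => hmem x (by omega) hxs
  have hQ := Q.rank_le_rank_add (show k ≤ s - 1 by omega)
  have hQs := Q.rank_eq_rank_pred_add (show 1 ≤ s by omega)
  rw [if_neg hs] at hQs
  omega

lemma Prec.dual_first_diff_ge {P Q : IndexSet n m} (h : Q.Prec P) {q : ℕ} (hq : q ∈ Q.carrier)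
    (hqP : q ∉ P.carrier) (heq : ∀ k < q, Q.rank k = P.rank k)
    (hq' : 2 * n + 3 - q ∈ P.carrier) : n + 3 ≤ 2 * n + 3 - q := by
  have hqN := Q.mem_bounds hq
  by_contra! hlt
  have hle : q ≤ n + 1 := by
    by_contra! hlt
    exact Q.dual_notMem hq ((mem_iff_of_rank_eq heq (by omega) (by omega)).2 hq')
  obtain rfl : q = n + 1 := by omega
  have hsub : Finset.Icc (n + 1) (n + 1) ⊆ P.sym := by
    rw [Finset.Icc_self, Finset.singleton_subset_iff, P.mem_sym (by omega) (by omega)]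
    exact Or.inr hq'
  have hmod := h.rank_modEq (by omega) le_rfl hsub (heq _ (by omega))
  have hn := heq n (by omega)
  rw [rank_succ, rank_succ, if_pos hq, if_neg hqP, hn] at hmod
  unfold Nat.ModEq at hmod
  omega

/-- The element `N + 1 - q` is lowered to the largest integer below it outside `P`. -/
lemma exists_move_of_dual_mem {P Q : IndexSet n m} (h : Q.Prec P) {q : ℕ}
    (hq : q ∈ Q.carrier) (hqP : q ∉ P.carrier) (hlt : P.rank q < Q.rank q)
    (heq : ∀ k < q, Q.rank k = P.rank k) (hq' : 2 * n + 3 - q ∈ P.carrier) :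
    ∃ R, Move P R ∧ Q.Le R ∧ (P.type ≠ 0 → R.type ≠ 0 → R.type = P.type) := by
  have hqN := Q.mem_bounds hq
  have hle := le_iff_rank_le.1 h.1
  have hge := h.dual_first_diff_ge hq hqP heq hq'
  obtain ⟨r, hr1, hr, hrP, hrmem⟩ := exists_last_notMem_below hge hq'
  have hgap : ∀ k, r ≤ k → k < 2 * n + 3 - q → P.rank k < Q.rank k := fun k =>
    rank_lt_rank_of_forall_mem (hle _) (Q.dual_notMem hq) hrmem
  have hdual : ∀ x, q ≤ x → x < 2 * n + 3 - r → 2 * n + 3 - x ∈ P.carrier := fun x h1 h2 =>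
    hrmem _ (by omega) (by omega)
  have hflat : ∀ k, q ≤ k → k < 2 * n + 3 - r → P.rank k < Q.rank k := by
    intro k h1 h2
    have h3 := P.rank_eq_of_forall_notMem h1 fun x hx hxk hxP =>
      P.dual_notMem hxP (hdual x hx.le (by omega))
    have h4 := Q.rank_mono h1
    omega
  have hmid : r = n + 1 → P.rank (n + 1) + 2 ≤ Q.rank (n + 1) := by
    intro hr
    have hsub : Finset.Icc q (n + 1) ⊆ P.sym := by
      intro x hx
      rw [Finset.mem_Icc] at hx
      exact (P.mem_sym (by omega) (by omega)).2 (Or.inr (hdual x hx.1 (by omega)))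
    have hmod := h.rank_modEq hqN.1 (by omega) hsub (heq _ (by omega))
    have := hgap (n + 1) (by omega) (by omega)
    unfold Nat.ModEq at hmod
    omega
  obtain ⟨R, hR⟩ := P.exists_isLowering (by omega) hr (by omega) hq' hrP
  refine ⟨R, ⟨_, r, hR⟩, le_iff_rank_le.2 fun k => ?_, hR.type_eq (Or.inr (Or.inl hr1))⟩
  have hRk := hR.rank_add k
  rw [show 2 * n + 3 - (2 * n + 3 - q) = q by omega] at hRk
  have := hle k
  have := hgap k
  have := hflat k
  rcases eq_or_ne k (n + 1) with rfl | hk <;> by_cases hr' : 2 * n + 3 - r ∈ P.carrier <;>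
    simp only [hr', true_and, false_and, if_false] at hRk <;> split_ifs at hRk <;> omega

lemma exists_move {P Q : IndexSet n m} (h : Q.Prec P) (hne : Q ≠ P) :
    ∃ R, Move P R ∧ Q.Le R ∧ (P.type ≠ 0 → R.type ≠ 0 → R.type = P.type) := by
  obtain ⟨q, hq, hqP, hlt, heq⟩ := exists_first_diff h.1 hne
  by_cases hq' : 2 * n + 3 - q ∈ P.carrier
  · exact exists_move_of_dual_mem h hq hqP hlt heq hq'
  · exact exists_move_of_dual_notMem h.1 hq hqP hlt hq'

lemma rank_lt_of_not_critical {P Q : IndexSet n m} (hle : Q.Le P) (hcrit : ¬ Q.Critical P)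
    {c : ℕ} (hP : Finset.Icc c (n + 1) ⊆ P.sym) (hQ : Finset.Icc c (n + 1) ⊆ Q.sym) {k : ℕ}
    (hck : c ≤ k + 1) (hk : k ≤ n) : P.rank k < Q.rank k := by
  refine (le_iff_rank_le.1 hle k).lt_of_ne fun heq => hcrit (critical_iff.2 ?_)
  have hsub : Finset.Icc (k + 1) (n + 1) ⊆ Finset.Icc c (n + 1) := Finset.Icc_subset_Icc_left hck
  exact ⟨k + 1, by omega, by omega, hsub.trans hP, hsub.trans hQ, heq.symm⟩

lemma exists_middle_mem {P : IndexSet n m} (hP : P.type ≠ 0) :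
    ∃ p ∈ P.carrier, p = n + 1 ∨ p = n + 2 := by
  rw [Ne, type_eq_zero_iff] at hP
  by_cases h : n + 1 ∈ P.carrier
  · exact ⟨_, h, Or.inl rfl⟩
  · exact ⟨n + 2, by tauto, Or.inr rfl⟩

lemma exists_move_type_zero_below {P Q : IndexSet n m} (hle : Q.Le P) (hcrit : ¬ Q.Critical P)
    {c : ℕ} (hc2 : 2 ≤ c) (hc : c ≤ n + 1) (hP : Finset.Icc c (n + 1) ⊆ P.sym)
    (hQ : Finset.Icc c (n + 1) ⊆ Q.sym) (hcP : c - 1 ∉ P.sym) :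
    ∃ R, Move P R ∧ R.type = 0 ∧ Q.Le R := by
  rw [P.mem_sym (by omega) (by omega), not_or] at hcP
  obtain ⟨p, hp, hmid⟩ := exists_middle_mem (type_ne_zero_iff.2 (hP (Finset.right_mem_Icc.2 hc)))
  obtain ⟨R, hR⟩ := P.exists_isLowering (show 1 ≤ c - 1 by omega) (show c - 1 < p by omega)
    (by omega) hp hcP.1
  refine ⟨R, ⟨p, c - 1, hR⟩, hR.type_eq_zero hmid (by omega) hcP.2, le_iff_rank_le.2 fun k => ?_⟩
  have hgap : ∀ k, c ≤ k + 1 → k ≤ n → P.rank k < Q.rank k := fun k =>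
    rank_lt_of_not_critical hle hcrit hP hQ
  rw [hR.rank_of_dual_notMem hcP.2]
  split_ifs with hk
  · rcases Nat.lt_or_ge n k with hnk | hkn
    · obtain ⟨rfl, rfl⟩ : k = n + 1 ∧ p = n + 2 := by omega
      have h1 := hgap n (by omega) le_rfl
      have h2 := Q.rank_mono (show n ≤ n + 1 by omega)
      rw [rank_succ, if_neg fun h => P.succ_middle_notMem h hp]
      omega
    · exact hgap k (by omega) hkn
  · exact le_iff_rank_le.1 hle k

lemma exists_move_type_zero_above {P Q : IndexSet n m} (hle : Q.Le P) (hcrit : ¬ Q.Critical P)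
    {c : ℕ} (hc2 : 2 ≤ c) (hc : c ≤ n + 1) (hP : Finset.Icc c (n + 1) ⊆ P.sym)
    (hQ : Finset.Icc c (n + 1) ⊆ Q.sym) (hcQ : c - 1 ∉ Q.sym) :
    ∃ R, Move R Q ∧ R.type = 0 ∧ R.Le P := by
  rw [Q.mem_sym (by omega) (by omega), not_or] at hcQ
  obtain ⟨p, hp, hmid⟩ := exists_middle_mem (type_ne_zero_iff.2 (hQ (Finset.right_mem_Icc.2 hc)))
  obtain ⟨R, hR⟩ := Q.exists_isLowering_to (show p < 2 * n + 3 - (c - 1) by omega) (by omega)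
    (by omega) hp hcQ.2
  have hmem := hR.mem_iff_or
  rw [show 2 * n + 3 - (2 * n + 3 - (c - 1)) = c - 1 by omega] at hmem
  have hp' : 2 * n + 3 - p ∉ R.carrier := fun h =>
    hcQ.1 ((hmem _).2 (Or.inr (Or.inl ⟨rfl, h⟩)))
  refine ⟨R, ⟨_, p, hR⟩, ?_, le_iff_rank_le.2 fun k => ?_⟩
  · have hpR := hR.notMem
    rw [type_eq_zero_iff]
    rcases hmid with rfl | rfl
    · exact ⟨hpR, by rwa [show 2 * n + 3 - (n + 1) = n + 2 by omega] at hp'⟩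
    · exact ⟨by rwa [show 2 * n + 3 - (n + 2) = n + 1 by omega] at hp', hpR⟩
  have hgap : ∀ k, c ≤ k + 1 → k ≤ n → P.rank k < Q.rank k := fun k =>
    rank_lt_of_not_critical hle hcrit hP hQ
  have hrank := hR.rank_of_dual_notMem hp' k
  split_ifs at hrank with hk
  · rcases Nat.lt_or_ge (n + 1) k with hnk | hkn
    · have hsub : Finset.Icc (2 * n + 3 - k) (n + 1) ⊆ Finset.Icc c (n + 1) :=
        Finset.Icc_subset_Icc_left (by omega)
      have h1 := (P.rank_dual_eq_iff (by omega) (by omega)).2 (hsub.trans hP)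
      have h2 := (Q.rank_dual_eq_iff (by omega) (by omega)).2 (hsub.trans hQ)
      have h3 := hgap (2 * n + 3 - k - 1) (by omega) (by omega)
      rw [show 2 * n + 3 - (2 * n + 3 - k) = k by omega] at h1 h2
      omega
    · obtain ⟨rfl, rfl⟩ : k = n + 1 ∧ p = n + 1 := by omega
      have h1 := hgap n (by omega) le_rfl
      have h2 := P.rank_le_rank_add (show n ≤ n + 1 by omega)
      rw [Q.rank_succ, if_pos hp] at hrank
      omega
  · have := le_iff_rank_le.1 hle k
    omega

lemma exists_type_zero_between {P Q : IndexSet n m} (hle : Q.Le P) (hcrit : ¬ Q.Critical P)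
    (hP : P.type ≠ 0) (hQ : Q.type ≠ 0) :
    (∃ R, Move P R ∧ R.type = 0 ∧ Q.Le R) ∨ ∃ R, Move R Q ∧ R.type = 0 ∧ R.Le P := by
  classical
  have hsymP := type_ne_zero_iff.1 hP
  have hsymQ := type_ne_zero_iff.1 hQ
  have hex : ∃ c, 1 ≤ c ∧ Finset.Icc c (n + 1) ⊆ P.sym ∧ Finset.Icc c (n + 1) ⊆ Q.sym :=
    ⟨n + 1, by omega, by simpa using hsymP, by simpa using hsymQ⟩
  have hc : Nat.find hex ≤ n + 1 :=
    Nat.find_min' hex ⟨by omega, by simpa using hsymP, by simpa using hsymQ⟩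
  have hmin := fun c => Nat.find_min (m := c) hex
  obtain ⟨hc1, hcP, hcQ⟩ := Nat.find_spec hex
  set c := Nat.find hex
  have hc2 : 2 ≤ c := by
    by_contra! hlt
    refine hcrit (critical_iff.2 ⟨c, hc1, hc, hcP, hcQ, ?_⟩)
    rw [show c - 1 = 0 by omega, rank_zero, rank_zero]
  have hinsert : Finset.Icc (c - 1) (n + 1) = insert (c - 1) (Finset.Icc c (n + 1)) := by
    ext x
    simp only [Finset.mem_insert, Finset.mem_Icc]
    omega
  by_cases hPc : c - 1 ∈ P.sym
  · by_cases hQc : c - 1 ∈ Q.sym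
    · refine (hmin (c - 1) (by omega) ⟨by omega, ?_, ?_⟩).elim <;>
        rw [hinsert, Finset.insert_subset_iff]
      exacts [⟨hPc, hcP⟩, ⟨hQc, hcQ⟩]
    · exact Or.inr (exists_move_type_zero_above hle hcrit hc2 hc hcP hcQ hQc)
  · exact Or.inl (exists_move_type_zero_below hle hcrit hc2 hc hcP hcQ hPc)

/-- The sum of the elements, a measure of termination for chains of moves. -/
def weight (P : IndexSet n m) : ℕ := ∑ j, P.elt j

lemma Le.weight_le {P R : IndexSet n m} (h : R.Le P) : R.weight ≤ P.weight :=
  Finset.sum_le_sum fun j _ => h j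

lemma Le.weight_lt {P R : IndexSet n m} (h : R.Le P) (hne : R ≠ P) : R.weight < P.weight := by
  refine Finset.sum_lt_sum (fun j _ => h j) ?_
  by_contra! hge
  exact hne (ext_elt fun j => (h j).antisymm (hge j (Finset.mem_univ j)))

lemma exists_move_prec_or_move_to {P Q : IndexSet n m} (h : Q.Prec P) (hne : Q ≠ P) :
    (∃ R, Move P R ∧ Q.Prec R) ∨ ∃ R, Move R Q ∧ R.Prec P := by
  obtain ⟨R, hmove, hle, htype⟩ := exists_move h hne
  by_cases hQR : Q.Prec R
  · exact Or.inl ⟨R, hmove, hQR⟩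
  have hQ : Q.type ≠ 0 := fun h0 => hQR (prec_of_type_eq_zero hle (Or.inl h0))
  have hR : R.type ≠ 0 := fun h0 => hQR (prec_of_type_eq_zero hle (Or.inr h0))
  by_cases hP : P.type = 0
  · have hQR' := (prec_or_prec_iota hR fun k _ => le_iff_rank_le.1 hle k).resolve_left hQR
    exact Or.inl ⟨R.iota, hmove.iota hP hR, hQR'⟩
  have hcrit : ¬ Q.Critical P := fun hc =>
    hQR ⟨hle, fun _ => (h.2 hc).trans (htype hP hR).symm⟩
  rcases exists_type_zero_between h.1 hcrit hP hQ with ⟨T, hT, hT0, hTle⟩ | ⟨T, hT, hT0, hTle⟩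
  · exact Or.inl ⟨T, hT, prec_of_type_eq_zero hTle (Or.inr hT0)⟩
  · exact Or.inr ⟨T, hT, prec_of_type_eq_zero hTle (Or.inl hT0)⟩

lemma reachable_of_prec {P Q : IndexSet n m} (h : Q.Prec P) : Relation.ReflTransGen Move P Q := by
  induction hw : P.weight - Q.weight using Nat.strong_induction_on generalizing P Q with
  | _ w ih =>
    subst hw
    rcases eq_or_ne Q P with rfl | hne
    · exact Relation.ReflTransGen.refl
    rcases exists_move_prec_or_move_to h hne with ⟨R, hmove, hR⟩ | ⟨R, hmove, hR⟩
    · have hlt := hmove.le.weight_lt hmove.ne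
      have := hR.1.weight_le
      exact Relation.ReflTransGen.head hmove (ih _ (by omega) hR rfl)
    · have hlt := hmove.le.weight_lt hmove.ne
      have := hR.1.weight_le
      exact Relation.ReflTransGen.tail (ih _ (by omega) hR rfl) hmove

end IndexSet

section BasisImages

variable {K V ι : Type*} [Field K] [AddCommGroup V] [Module K V] (e : Module.Basis ι K V)

lemma mem_span_basis_image {A : Set ι} {x : V} :
    x ∈ Submodule.span K (e '' A) ↔ ∀ i, i ∉ A → e.repr x i = 0 := by
  simp only [Module.Basis.mem_span_image, Set.subset_def, Finset.mem_coe, Finsupp.mem_support_iff,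
    not_imp_comm]

lemma finrank_span_basis_image (A : Set ι) :
    Module.finrank K (Submodule.span K (e '' A)) = A.ncard := by
  rw [Module.finrank, rank_span_set (e.linearIndependent.linearIndepOn A).id_image,
    ← Set.ncard_image_of_injective A e.injective]
  rfl

lemma span_basis_image_inf (A B : Set ι) :
    Submodule.span K (e '' A) ⊓ Submodule.span K (e '' B) = Submodule.span K (e '' (A ∩ B)) := by
  ext x
  simp only [Submodule.mem_inf, mem_span_basis_image, Set.mem_inter_iff, not_and_or, or_imp,
    forall_and]

lemma exists_leading_coord [LinearOrder ι] {x : V} (hx : x ≠ 0) :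
    ∃ q, e.repr x q ≠ 0 ∧ ∀ i, q < i → e.repr x i = 0 := by
  have hne : (e.repr x).support.Nonempty :=
    Finsupp.support_nonempty_iff.2 fun h => hx (e.repr.map_eq_zero_iff.1 h)
  refine ⟨(e.repr x).support.max' hne, Finsupp.mem_support_iff.1 (Finset.max'_mem _ hne),
    fun i hi => ?_⟩
  by_contra h
  exact hi.not_ge (Finset.le_max' _ i (Finsupp.mem_support_iff.2 h))

end BasisImages

section Eichler

variable {K V : Type*} [Field K] [AddCommGroup V] [Module K V]

/-- The Eichler transformation (Siegel transvection) attached to an isotropic vector `a` and a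
vector `y` orthogonal to `a`. These isometries play the role of the root subgroups of the
orthogonal group. -/
def eichler (b : LinearMap.BilinForm K V) (a y : V) : V →ₗ[K] V :=
  LinearMap.id + (b a).smulRight (y - (b y y / 2) • a) - (b y).smulRight a

variable {b : LinearMap.BilinForm K V} {a y : V}

lemma eichler_apply (a y v : V) :
    eichler b a y v = v + b a v • (y - (b y y / 2) • a) - b y v • a := rfl

lemma eichler_zero (a : V) : eichler b a 0 = LinearMap.id := by
  ext v
  simp [eichler_apply]

lemma det_mul_self_of_isometry [FiniteDimensional K V] (hnondeg : b.Nondegenerate)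
    {g : V →ₗ[K] V} (hg : ∀ x y, b (g x) (g y) = b x y) :
    LinearMap.det g * LinearMap.det g = 1 := by
  let e := Module.finBasis K V
  have hcomp : b.comp g g = b := LinearMap.ext₂ hg
  have hdet := congrArg Matrix.det (LinearMap.BilinForm.toMatrix_comp e e b g g)
  rw [hcomp, Matrix.det_mul, Matrix.det_mul, Matrix.det_transpose, LinearMap.det_toMatrix] at hdet
  apply mul_left_cancel₀ ((LinearMap.BilinForm.nondegenerate_iff_det_ne_zero e).1 hnondeg)
  linear_combination -hdet

variable [NeZero (2 : K)]

lemma eichler_isometry (hsymm : b.IsSymm) (ha : b a a = 0) (hay : b a y = 0) (v w : V) :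
    b (eichler b a y v) (eichler b a y w) = b v w := by
  have hya : b y a = 0 := (hsymm.eq y a).trans hay
  simp only [eichler_apply, map_add, map_sub, map_smul, LinearMap.add_apply, LinearMap.sub_apply,
    LinearMap.smul_apply, smul_eq_mul, ha, hay, hya, hsymm.eq v a, hsymm.eq v y]
  field_simp
  ring

lemma eichler_comp (hsymm : b.IsSymm) {z : V} (ha : b a a = 0) (hay : b a y = 0)
    (haz : b a z = 0) : eichler b a y ∘ₗ eichler b a z = eichler b a (y + z) := by
  have hya : b y a = 0 := (hsymm.eq y a).trans hay
  ext v
  simp only [LinearMap.comp_apply, eichler_apply, map_add, map_sub, map_smul, LinearMap.add_apply,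
    ha, haz, hya, hsymm.eq y z]
  match_scalars <;> field_simp <;> ring

/-- The Eichler transformation as a linear automorphism, with inverse the transformation
attached to `a` and `-y`. -/
def eichlerEquiv (hsymm : b.IsSymm) (ha : b a a = 0) (hay : b a y = 0) : V ≃ₗ[K] V :=
  LinearEquiv.ofLinearMap (eichler b a y) (eichler b a (-y))
    (by rw [eichler_comp hsymm ha hay (by simp [hay]), add_neg_cancel, eichler_zero])
    (by rw [eichler_comp hsymm ha (by simp [hay]) hay, neg_add_cancel, eichler_zero])

lemma eichlerEquiv_apply (hsymm : b.IsSymm) (ha : b a a = 0) (hay : b a y = 0) (v : V) :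
    eichlerEquiv hsymm ha hay v = v + b a v • (y - (b y y / 2) • a) - b y v • a := rfl

/-- Being the square of the isometry attached to `a` and `y / 2`, it cannot have
determinant `-1`. -/
lemma det_eichler [FiniteDimensional K V] (hnondeg : b.Nondegenerate) (hsymm : b.IsSymm)
    (ha : b a a = 0) (hay : b a y = 0) : LinearMap.det (eichler b a y) = 1 := by
  have hay' : b a ((2⁻¹ : K) • y) = 0 := by simp [hay]
  have hsq : eichler b a y = eichler b a ((2⁻¹ : K) • y) ∘ₗ eichler b a ((2⁻¹ : K) • y) := by
    rw [eichler_comp hsymm ha hay' hay', ← add_smul, ← two_mul,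
      mul_inv_cancel₀ (NeZero.ne (2 : K)), one_smul]
  rw [hsq, LinearMap.det_comp]
  exact det_mul_self_of_isometry hnondeg (eichler_isometry hsymm ha hay')

lemma eichlerEquiv_apply_eq_of_isotropic (hsymm : b.IsSymm) {u : V} {c : K} (ha : b a a = 0)
    (hu : b u u = 0) (hau : b a u = 1) (hay : b a y = 0) (hyu : b y u = 0)
    (hw : b (u + y + c • a) (u + y + c • a) = 0) :
    eichlerEquiv hsymm ha hay u = u + y + c • a := by
  have hc : c = -(b y y / 2) := by
    simp only [map_add, map_smul, LinearMap.add_apply, LinearMap.smul_apply, smul_eq_mul,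
      hsymm.eq u a, hsymm.eq u y, hsymm.eq y a, hau, hu, hay, hyu, ha] at hw
    have := NeZero.ne (2 : K)
    field_simp
    linear_combination hw
  rw [eichlerEquiv_apply, hau, hyu, hc]
  module

end Eichler

section IsotropicFlag

variable {V : Type*} [AddCommGroup V] [Module ℂ V] {n m : ℕ}

section Dual

/-- The index `N + 1 - i` of the basis vector that pairs to `1` with `e i`, where
`N = 2 * n + 2`. -/
def dual (i : Idx (2 * n + 2)) : Idx (2 * n + 2) :=
  ⟨2 * n + 3 - i, by
    have := Finset.mem_Icc.1 i.2
    rw [Finset.mem_Icc]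
    omega⟩

lemma idx_bounds {N : ℕ} (i : Idx N) : 1 ≤ (i : ℕ) ∧ (i : ℕ) ≤ N := Finset.mem_Icc.1 i.2

lemma coe_dual (i : Idx (2 * n + 2)) : (dual i : ℕ) = 2 * n + 3 - i := rfl

lemma dual_dual (i : Idx (2 * n + 2)) : dual (dual i) = i := by
  have := idx_bounds i
  apply Subtype.ext
  rw [coe_dual, coe_dual]
  omega

lemma dual_injective : Function.Injective (dual (n := n)) :=
  Function.LeftInverse.injective dual_dual

lemma dual_eq_iff {i j : Idx (2 * n + 2)} : dual i = j ↔ (i : ℕ) + j = 2 * n + 3 := by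
  have := idx_bounds i
  have := idx_bounds j
  rw [Subtype.ext_iff, coe_dual]
  omega

lemma dual_ne_self (i : Idx (2 * n + 2)) : dual i ≠ i := by
  rw [Ne, dual_eq_iff]
  omega

end Dual

variable {b : LinearMap.BilinForm ℂ V} {F : ℕ → Submodule ℂ V}
  {e : Module.Basis (Idx (2 * n + 2)) ℂ V}

namespace IsAdapted

variable (he : IsAdapted b (2 * n + 2) F e)

include he

lemma apply_basis (i j : Idx (2 * n + 2)) : b (e i) (e j) = if dual i = j then 1 else 0 := by
  simp only [he.pairing, dual_eq_iff]

lemma apply_basis_left (i : Idx (2 * n + 2)) (x : V) : b (e i) x = e.repr x (dual i) := by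
  conv_lhs => rw [← e.sum_repr x]
  simp [he.apply_basis]

lemma apply_self (i : Idx (2 * n + 2)) : b (e i) (e i) = 0 := by
  rw [he.apply_basis, if_neg (dual_ne_self i)]

lemma apply_eq_sum (x y : V) : b x y = ∑ i, e.repr x i * e.repr y (dual i) := by
  conv_lhs => rw [← e.sum_repr x]
  simp only [map_sum, map_smul, LinearMap.sum_apply, LinearMap.smul_apply, smul_eq_mul,
    he.apply_basis_left]

lemma isSymm : b.IsSymm := by
  refine ⟨fun x y => LinearMap.congr_fun₂ (e.ext fun i => e.ext fun j => ?_ : b = b.flip) x y⟩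
  change b (e i) (e j) = b (e j) (e i)
  rw [he.pairing, he.pairing, add_comm]

lemma nondegenerate : b.Nondegenerate := by
  refine he.isSymm.isRefl.nondegenerate_iff_separatingLeft.2 fun x hx => ?_
  refine e.repr.map_eq_zero_iff.1 (Finsupp.ext fun i => ?_)
  rw [← dual_dual i, ← he.apply_basis_left, he.isSymm.eq]
  exact hx _

lemma mem_flag {p : ℕ} (hp : p ≤ 2 * n + 2) {x : V} :
    x ∈ F p ↔ ∀ i : Idx (2 * n + 2), p < i → e.repr x i = 0 := by
  simp only [he.flag p hp, mem_span_basis_image, Set.mem_ofPred_eq, not_le]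

lemma basis_mem_flag {p : ℕ} (hp : p ≤ 2 * n + 2) {i : Idx (2 * n + 2)} (hi : (i : ℕ) ≤ p) :
    e i ∈ F p := by
  rw [he.flag p hp]
  exact Submodule.subset_span ⟨i, hi, rfl⟩

lemma flag_mono {p q : ℕ} (hpq : p ≤ q) (hq : q ≤ 2 * n + 2) : F p ≤ F q := by
  rw [he.flag p (hpq.trans hq), he.flag q hq]
  exact Submodule.span_mono (Set.image_mono fun i hi => le_trans hi hpq)

lemma apply_eq_zero {p q : ℕ} (hpq : p + q ≤ 2 * n + 2) {x y : V} (hx : x ∈ F p) (hy : y ∈ F q) :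
    b x y = 0 := by
  rw [he.apply_eq_sum]
  refine Finset.sum_eq_zero fun i _ => ?_
  rcases lt_or_ge p i with hi | hi
  · rw [(he.mem_flag (by omega)).1 hx i hi, zero_mul]
  · rw [(he.mem_flag (by omega)).1 hy (dual i) (by rw [coe_dual]; omega), mul_zero]

end IsAdapted

section Borel

variable {N : ℕ} {g h : V ≃ₗ[ℂ] V}

lemma refl_mem_borel : LinearEquiv.refl ℂ V ∈ borel b N F :=
  ⟨fun _ _ => rfl, by simp, fun p _ => by simp⟩

lemma trans_mem_borel (hg : g ∈ borel b N F) (hh : h ∈ borel b N F) :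
    g.trans h ∈ borel b N F := by
  refine ⟨fun x y => ?_, ?_, fun p hp => ?_⟩
  · rw [LinearEquiv.trans_apply, LinearEquiv.trans_apply, hh.1, hg.1]
  · rw [LinearEquiv.coe_trans, LinearMap.det_comp, hg.2.1, hh.2.1, one_mul]
  · rw [LinearEquiv.coe_trans, Submodule.map_comp, hg.2.2 p hp, hh.2.2 p hp]

lemma map_mem_OG (hg : ∀ x y, b (g x) (g y) = b x y) {S : Submodule ℂ V} (hS : S ∈ OG b m) :
    S.map (g : V →ₗ[ℂ] V) ∈ OG b m := by
  refine ⟨by rw [LinearEquiv.finrank_map_eq, hS.1], ?_⟩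
  rintro _ ⟨x, hx, rfl⟩ _ ⟨y, hy, rfl⟩
  exact (hg x y).trans (hS.2 x hx y hy)

lemma coordSubspace_mem_schubertCell (P : IndexSet n m) :
    coordSubspace e P ∈ schubertCell b F e P :=
  ⟨LinearEquiv.refl ℂ V, refl_mem_borel, by simp⟩

lemma map_mem_schubertCell (hg : g ∈ borel b (2 * n + 2) F) {P : IndexSet n m} {S : Submodule ℂ V}
    (hS : S ∈ schubertCell b F e P) : S.map (g : V →ₗ[ℂ] V) ∈ schubertCell b F e P := by
  obtain ⟨h, hh, rfl⟩ := hS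
  exact ⟨h.trans g, trans_mem_borel hh hg, by rw [LinearEquiv.coe_trans, Submodule.map_comp]⟩

lemma eichler_mem_flag (he : IsAdapted b (2 * n + 2) F e) {q : Idx (2 * n + 2)} {y v : V}
    (hy : y ∈ F (q - 1)) {p : ℕ} (hp : p ≤ 2 * n + 2) (hv : v ∈ F p) :
    eichler b (e (dual q)) y v ∈ F p := by
  have hq := idx_bounds q
  have hterm : b (e (dual q)) v • y ∈ F p := by
    rcases lt_or_ge p q with hpq | hqp
    · rw [he.apply_basis_left, dual_dual, (he.mem_flag hp).1 hv q hpq, zero_smul]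
      exact zero_mem _
    · exact Submodule.smul_mem _ _ (he.flag_mono (by omega) hp hy)
  rcases le_or_gt (dual q : ℕ) p with hle | hlt
  · have ha : e (dual q) ∈ F p := he.basis_mem_flag hp hle
    rw [eichler_apply, smul_sub]
    exact sub_mem (add_mem hv (sub_mem hterm (Submodule.smul_mem _ _ (Submodule.smul_mem _ _ ha))))
      (Submodule.smul_mem _ _ ha)
  rw [coe_dual] at hlt
  have hyv : b y v = 0 := he.apply_eq_zero (by omega) hy hv
  have hscalar : b (e (dual q)) v * b y y = 0 := by
    rcases lt_or_ge p q with hpq | hqp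
    · rw [he.apply_basis_left, dual_dual, (he.mem_flag hp).1 hv q hpq, zero_mul]
    · rw [he.apply_eq_zero (by omega) hy hy, mul_zero]
  have hterm_eq : eichler b (e (dual q)) y v = v + b (e (dual q)) v • y := by
    rw [eichler_apply, hyv, smul_sub, smul_smul, mul_div_assoc', hscalar]
    module
  rw [hterm_eq]
  exact add_mem hv hterm

lemma eichlerEquiv_mem_borel (he : IsAdapted b (2 * n + 2) F e) {q : Idx (2 * n + 2)} {y : V}
    (hy : y ∈ F (q - 1)) (hay : b (e (dual q)) y = 0) :
    eichlerEquiv he.isSymm (he.apply_self (dual q)) hay ∈ borel b (2 * n + 2) F := by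
  have := Module.Finite.of_basis e
  refine ⟨eichler_isometry he.isSymm (he.apply_self _) hay,
    det_eichler he.nondegenerate he.isSymm (he.apply_self _) hay, fun p hp => le_antisymm ?_ ?_⟩
  · rintro _ ⟨v, hv, rfl⟩
    exact eichler_mem_flag he hy hp hv
  · intro v hv
    exact ⟨_, eichler_mem_flag he (neg_mem hy) hp hv,
      (eichlerEquiv he.isSymm (he.apply_self _) hay).apply_symm_apply v⟩

end Borel

section Bruhat

lemma exists_mem_borel_apply_basis (he : IsAdapted b (2 * n + 2) F e) {q : Idx (2 * n + 2)} {w : V}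
    (hw : b w w = 0) (hwq : e.repr w q = 1) (hlead : ∀ i, q < i → e.repr w i = 0) :
    ∃ g ∈ borel b (2 * n + 2) F, g (e q) = w ∧
      ∀ j ≠ q, e.repr w (dual j) = 0 → g (e j) = e j := by
  set c := e.repr w (dual q)
  set y : V := w - e q - c • e (dual q) with hy_def
  have hy_coord (i) : e.repr y i = e.repr w i - (if q = i then 1 else 0)
      - c * (if dual q = i then 1 else 0) := by
    simp [y, Finsupp.single_apply]
  have hy : y ∈ F (q - 1) := by
    have hq := idx_bounds q
    refine (he.mem_flag (by omega)).2 fun i hi => ?_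
    rw [hy_coord]
    rcases (show q ≤ i from Subtype.coe_le_coe.1 (by omega)).eq_or_lt with rfl | hqi
    · simp [hwq, dual_ne_self]
    · by_cases hi' : dual q = i
      · simp [← hi', c, (dual_ne_self q).symm]
      · simp [hlead i hqi, hqi.ne, hi']
  have hay : b (e (dual q)) y = 0 := by
    simp [he.apply_basis_left, dual_dual, hy_coord, hwq, dual_ne_self]
  have hw_eq : w = e q + y + c • e (dual q) := by
    rw [hy_def]
    abel
  refine ⟨_, eichlerEquiv_mem_borel he hy hay, ?_, fun j hjq hj => ?_⟩
  · conv_rhs => rw [hw_eq]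
    refine eichlerEquiv_apply_eq_of_isotropic _ _ (he.apply_self q) ?_ hay ?_ (hw_eq ▸ hw)
    · rw [he.apply_basis, dual_dual, if_pos rfl]
    · simp [he.isSymm.eq y, he.apply_basis_left, hy_coord, c, (dual_ne_self q).symm]
  · have hqj : q ≠ dual j := by
      rintro rfl
      exact one_ne_zero (hwq.symm.trans hj)
    have hyj : b y (e j) = 0 := by
      simp [he.isSymm.eq y, he.apply_basis_left, hy_coord, hj, hqj, hjq.symm, dual_injective.eq_iff]
    rw [eichlerEquiv_apply, hyj, he.apply_basis, dual_dual, if_neg hjq.symm]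
    simp

lemma eq_span_of_disjoint_compl {K W ι : Type*} [Field K] [AddCommGroup W] [Module K W]
    (e : Module.Basis ι K W) {S : Submodule K W}
    (hS : Disjoint S (Submodule.span K (e '' {i | e i ∈ S}ᶜ))) :
    S = Submodule.span K (e '' {i | e i ∈ S}) := by
  set T := Submodule.span K (e '' {i | e i ∈ S})
  set T' := Submodule.span K (e '' {i | e i ∈ S}ᶜ)
  have hle : T ≤ S := Submodule.span_le.2 (Set.image_subset_iff.2 fun _ hi => hi)
  have htop : T ⊔ T' = ⊤ := by
    rw [← Submodule.span_union, ← Set.image_union, Set.union_compl_self, Set.image_univ, e.span_eq]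
  calc S = (T ⊔ T') ⊓ S := by rw [htop, top_inf_eq]
    _ = T := by rw [sup_inf_assoc_of_le _ hle, inf_comm, hS.eq_bot, sup_bot_eq]

lemma exists_eq_coordSubspace (he : IsAdapted b (2 * n + 2) F e) {S : Submodule ℂ V}
    (hS : S ∈ OG b m) (hspan : S = Submodule.span ℂ (e '' {i | e i ∈ S})) :
    ∃ Q : IndexSet n m, S = coordSubspace e Q := by
  classical
  let Q : IndexSet n m :=
    { carrier := (Finset.univ.filter fun i => e i ∈ S).map (Function.Embedding.subtype _)
      subset_Icc := Finset.map_subtype_subset _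
      card_eq := by
        rw [Finset.card_map, ← Set.ncard_coe_finset, Finset.coe_filter_univ,
          ← finrank_span_basis_image e, ← hspan, hS.1]
      add_ne := by
        simp only [Finset.mem_map, Finset.mem_filter, Finset.mem_univ, true_and]
        rintro _ ⟨i, hi, rfl⟩ _ ⟨j, hj, rfl⟩ hij
        have hpair := hS.2 _ hi _ hj
        rw [he.apply_basis, if_pos (dual_eq_iff.2 hij)] at hpair
        exact one_ne_zero hpair }
  refine ⟨Q, hspan.trans ?_⟩
  rw [coordSubspace]
  congr 2
  ext i
  simp [Q]

lemma exists_mem_borel_apply_basis_mem (he : IsAdapted b (2 * n + 2) F e) {S : Submodule ℂ V}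
    (hS : S ∈ OG b m) (hdisj : ¬Disjoint S (Submodule.span ℂ (e '' {i | e i ∈ S}ᶜ))) :
    ∃ g ∈ borel b (2 * n + 2) F, ∃ q, e q ∉ S ∧ g (e q) ∈ S ∧ ∀ j, e j ∈ S → g (e j) = e j := by
  rw [disjoint_iff, Submodule.eq_bot_iff] at hdisj
  push Not at hdisj
  obtain ⟨w, ⟨hwS, hw⟩, hw0⟩ := hdisj
  obtain ⟨q, hq, hlead⟩ := exists_leading_coord e hw0
  have hqS : e q ∉ S := fun h => hq ((mem_span_basis_image e).1 hw q (not_not.2 h))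
  have hw'S : (e.repr w q)⁻¹ • w ∈ S := S.smul_mem _ hwS
  obtain ⟨g, hg, hgq, hgj⟩ := exists_mem_borel_apply_basis he (q := q)
    (hS.2 _ hw'S _ hw'S) (by simp [hq]) (fun i hi => by simp [hlead i hi])
  refine ⟨g, hg, q, hqS, hgq ▸ hw'S, fun j hj => hgj j (fun h => hqS (h ▸ hj)) ?_⟩
  rw [← he.apply_basis_left]
  exact hS.2 _ hj _ hw'S

/-- Bruhat decomposition. As long as `S` is not a coordinate subspace, it contains a vector without
coordinates at the basis vectors in `S`; moving this vector to its leading basis vector enlarges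
the set of basis vectors in `S`. -/
lemma exists_mem_schubertCell (he : IsAdapted b (2 * n + 2) F e) {S : Submodule ℂ V}
    (hS : S ∈ OG b m) : ∃ Q : IndexSet n m, S ∈ schubertCell b F e Q := by
  induction hd : {j | e j ∉ S}.ncard using Nat.strong_induction_on generalizing S with
  | _ d ih =>
    subst hd
    by_cases hdisj : Disjoint S (Submodule.span ℂ (e '' {i | e i ∈ S}ᶜ))
    · obtain ⟨Q, rfl⟩ := exists_eq_coordSubspace he hS (eq_span_of_disjoint_compl e hdisj)
      exact ⟨Q, coordSubspace_mem_schubertCell Q⟩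
    obtain ⟨g, hg, q, hqS, hgq, hgj⟩ := exists_mem_borel_apply_basis_mem he hS hdisj
    set S' := S.comap (g : V →ₗ[ℂ] V) with hS'_def
    have hS' : S' ∈ OG b m := by
      rw [hS'_def, Submodule.comap_equiv_eq_map_symm]
      refine map_mem_OG (fun x y => ?_) hS
      rw [← hg.1, g.apply_symm_apply, g.apply_symm_apply]
    have hlt : {j | e j ∉ S'}.ncard < {j | e j ∉ S}.ncard := by
      have hsub : {j | e j ∉ S'} ⊆ {j | e j ∉ S} := fun j hj hjS =>
        hj (Submodule.mem_comap.2 ((hgj j hjS).symm ▸ hjS : g (e j) ∈ S))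
      exact Set.ncard_lt_ncard ((Set.ssubset_iff_of_subset hsub).2 ⟨q, hqS, not_not.2 hgq⟩)
        (Set.toFinite _)
    obtain ⟨Q, hQ⟩ := ih _ hlt hS' rfl
    have hmap := map_mem_schubertCell hg hQ
    rw [Submodule.map_comap_eq_of_surjective g.surjective] at hmap
    exact ⟨Q, hmap⟩

end Bruhat

end IsotropicFlag

section ClosureRelations

variable {V : Type*} [AddCommGroup V] [Module ℂ V] {n m : ℕ}
  {b : LinearMap.BilinForm ℂ V} {F : ℕ → Submodule ℂ V}
  {e : Module.Basis (Idx (2 * n + 2)) ℂ V}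

section CoordSubspace

lemma ncard_idx {N : ℕ} {A : Finset ℕ} (hA : A ⊆ Finset.Icc 1 N) :
    {i : Idx N | (i : ℕ) ∈ A}.ncard = A.card := by
  rw [← Set.ncard_coe_finset, ← Set.ncard_image_of_injective _ Subtype.val_injective]
  congr 1
  ext x
  simpa using fun hx => Finset.mem_Icc.1 (hA hx)

lemma basis_mem_coordSubspace {P : IndexSet n m} {i : Idx (2 * n + 2)}
    (hi : (i : ℕ) ∈ P.carrier) : e i ∈ coordSubspace e P :=
  Submodule.subset_span ⟨i, hi, rfl⟩

lemma finrank_coordSubspace (P : IndexSet n m) :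
    Module.finrank ℂ (coordSubspace e P) = m := by
  rw [coordSubspace, finrank_span_basis_image, ncard_idx P.subset_Icc, P.card_eq]

lemma coordSubspace_mem_OG (he : IsAdapted b (2 * n + 2) F e) (P : IndexSet n m) :
    coordSubspace e P ∈ OG b m := by
  refine ⟨finrank_coordSubspace P, fun x hx y hy => ?_⟩
  rw [coordSubspace, mem_span_basis_image] at hx hy
  rw [he.apply_eq_sum]
  refine Finset.sum_eq_zero fun i _ => ?_
  by_cases hi : (i : ℕ) ∈ P.carrier
  · rw [hy _ (P.dual_notMem hi), mul_zero]
  · rw [hx _ hi, zero_mul]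

lemma schubertCell_subset_OG (he : IsAdapted b (2 * n + 2) F e) (P : IndexSet n m) :
    schubertCell b F e P ⊆ OG b m := by
  rintro _ ⟨g, hg, rfl⟩
  exact map_mem_OG hg.1 (coordSubspace_mem_OG he P)

end CoordSubspace

section ZariskiClosure

variable {N : ℕ} {e : Module.Basis (Idx N) ℂ V} {A B : Set (Submodule ℂ V)}

lemma subset_zariskiClosure (hA : A ⊆ OG b m) : A ⊆ zariskiClosure b m e A :=
  fun S hS => ⟨hA hS, fun _ _ _ h => h S hS⟩

lemma zariskiClosure_subset (h : A ⊆ zariskiClosure b m e B) :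
    zariskiClosure b m e A ⊆ zariskiClosure b m e B :=
  fun _ hS => ⟨hS.1, fun d f hf hB => hS.2 d f hf fun _ hT => (h hT).2 d f hf hB⟩

lemma mem_zariskiClosure_of_family {S : Submodule ℂ V} (hS : S ∈ OG b m) (h : ℂ → V ≃ₗ[ℂ] V)
    (h0 : ∀ v, h 0 v = v) (hcont : ∀ v i, Continuous fun t => e.repr (h t v) i)
    (hA : ∀ t, t ≠ 0 → S.map (h t : V →ₗ[ℂ] V) ∈ A) : S ∈ zariskiClosure b m e A := by
  refine ⟨hS, fun d f _ hf v hv hvS => ?_⟩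
  let φ : ℂ → ℂ := fun t => MvPolynomial.eval (plucker e fun r => h t (v r)) f
  have hφ : Continuous φ := (MvPolynomial.continuous_eval f).comp <|
    continuous_pi fun I => Continuous.matrix_det (continuous_matrix fun r s => hcont _ _)
  have hφ0 : φ = fun _ => 0 := by
    refine Continuous.ext_on (dense_compl_singleton (0 : ℂ)) hφ continuous_const fun t ht => ?_
    refine hf _ (hA t ht) _ (hv.map' (h t : V →ₗ[ℂ] V) (LinearEquiv.ker _)) ?_
    rw [← hvS, Submodule.map_span, ← Set.range_comp]
    rfl
  simpa only [φ, h0] using congrFun hφ0 0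

end ZariskiClosure

section RootSubgroups

/-- The one-parameter root subgroup of the special orthogonal group that maps `e k` to
`e k + s • e l` and `e (dual l)` to `e (dual l) - s • e (dual k)`. -/
def rootEquiv (he : IsAdapted b (2 * n + 2) F e) {k l : Idx (2 * n + 2)} (hkl : k ≠ l) (s : ℂ) :
    V ≃ₗ[ℂ] V :=
  eichlerEquiv he.isSymm (he.apply_self (dual k)) (y := s • e l)
    (by rw [map_smul, he.apply_basis, dual_dual, if_neg hkl, smul_zero])

variable (he : IsAdapted b (2 * n + 2) F e) {k l : Idx (2 * n + 2)} (hkl : k ≠ l)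

lemma rootEquiv_apply (s : ℂ) (v : V) :
    rootEquiv he hkl s v =
      v + (s * e.repr v k) • e l - (s * e.repr v (dual l)) • e (dual k) := by
  simp only [rootEquiv, eichlerEquiv_apply, map_smul, LinearMap.smul_apply, he.apply_self,
    he.apply_basis_left, dual_dual, smul_eq_mul]
  module

lemma rootEquiv_apply_basis (s : ℂ) (i : Idx (2 * n + 2)) :
    rootEquiv he hkl s (e i) = e i + (if i = k then s else 0) • e l
      - (if i = dual l then s else 0) • e (dual k) := by
  simp only [rootEquiv_apply, Module.Basis.repr_self_apply, mul_ite, mul_one, mul_zero]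

lemma rootEquiv_mem_borel (hlt : l < k) (s : ℂ) :
    rootEquiv he hlt.ne' s ∈ borel b (2 * n + 2) F := by
  have hk := idx_bounds k
  have hlk : (l : ℕ) < k := hlt
  exact eichlerEquiv_mem_borel he
    (Submodule.smul_mem _ _ (he.basis_mem_flag (by omega) (by omega))) _

lemma map_rootEquiv_coordSubspace {p q : Idx (2 * n + 2)} (hpq : p ≠ q) {P R : IndexSet n m}
    (h : IndexSet.IsLowering p q P R) {t : ℂ} (ht : t ≠ 0) :
    (coordSubspace e R).map (rootEquiv he hpq.symm t : V →ₗ[ℂ] V) =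
      (coordSubspace e P).map (rootEquiv he hpq t⁻¹ : V →ₗ[ℂ] V) := by
  have := Module.Finite.of_basis e
  have hpq' : p ≠ dual q := fun h' => h.add_ne (by rw [add_comm]; exact dual_eq_iff.1 h'.symm)
  have hqp' : q ≠ dual p := fun h' => h.add_ne (dual_eq_iff.1 h'.symm)
  refine Submodule.eq_of_le_of_finrank_eq ?_
    (by simp only [LinearEquiv.finrank_map_eq, finrank_coordSubspace])
  rw [Submodule.map_le_iff_le_comap, coordSubspace, Submodule.span_le]
  rintro _ ⟨i, hi, rfl⟩
  have hmem {x : V} (j : Idx (2 * n + 2)) (hj : (j : ℕ) ∈ P.carrier) (c : ℂ)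
      (hx : x = c • rootEquiv he hpq t⁻¹ (e j)) :
      x ∈ (coordSubspace e P).map (rootEquiv he hpq t⁻¹ : V →ₗ[ℂ] V) :=
    hx ▸ Submodule.smul_mem _ _ ⟨e j, basis_mem_coordSubspace hj, rfl⟩
  rcases (h.mem_iff_or i).1 hi with hiq | ⟨hip, hqP⟩ | ⟨hip, hiq, hiP⟩
  · obtain rfl : i = q := Subtype.ext hiq
    refine hmem p h.mem t ?_
    simp [rootEquiv_apply_basis, hpq', hqp', ht, add_comm]
  · obtain rfl : i = dual p := Subtype.ext hip
    refine hmem (dual q) hqP (-t) ?_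
    simp [rootEquiv_apply_basis, hpq'.symm, hqp'.symm, ht, smul_sub, neg_add_eq_sub]
  · refine hmem i hiP 1 ?_
    have hip₁ : i ≠ p := fun h' => hip (congrArg _ h')
    have hiq₁ : i ≠ dual q := fun h' => hiq (congrArg _ h')
    have hip₂ : i ≠ dual p := fun h' => P.dual_notMem h.mem (by rwa [h'] at hiP)
    have hiq₂ : i ≠ q := fun h' => h.notMem (h' ▸ hiP)
    simp [rootEquiv_apply_basis, hip₁, hiq₁, hip₂, hiq₂]

end RootSubgroups

lemma schubertCell_subset_of_move (he : IsAdapted b (2 * n + 2) F e) {P R : IndexSet n m}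
    (hmove : P.Move R) : schubertCell b F e R ⊆ schubertVariety b F e P := by
  rintro S ⟨g, hg, rfl⟩
  obtain ⟨p', q', hlow⟩ := hmove
  obtain ⟨p, rfl⟩ : ∃ p : Idx (2 * n + 2), (p : ℕ) = p' := ⟨⟨p', P.subset_Icc hlow.mem⟩, rfl⟩
  obtain ⟨q, rfl⟩ : ∃ q : Idx (2 * n + 2), (q : ℕ) = q' := ⟨⟨q', R.subset_Icc hlow.mem_low⟩, rfl⟩
  have hqp : q < p := hlow.lt
  refine mem_zariskiClosure_of_family (schubertCell_subset_OG he R ⟨g, hg, rfl⟩)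
    (fun t => (g.symm.trans (rootEquiv he hqp.ne t)).trans g) ?_ ?_ fun t ht => ?_
  · intro v
    simp [rootEquiv_apply]
  · intro v i
    simp only [LinearEquiv.trans_apply, rootEquiv_apply, map_add, map_sub, map_smul,
      Finsupp.add_apply, Finsupp.sub_apply, Finsupp.smul_apply, smul_eq_mul]
    fun_prop
  · refine ⟨_, trans_mem_borel (rootEquiv_mem_borel he hqp t⁻¹) hg, ?_⟩
    have hcancel : ((coordSubspace e R).map (g : V →ₗ[ℂ] V)).map (g.symm : V →ₗ[ℂ] V) =
        coordSubspace e R := by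
      rw [← Submodule.map_comp, LinearEquiv.symm_comp, Submodule.map_id]
    simp only [LinearEquiv.coe_trans, Submodule.map_comp, hcancel,
      map_rootEquiv_coordSubspace he hqp.ne' hlow ht]

lemma schubertVariety_subset_of_prec (he : IsAdapted b (2 * n + 2) F e) {P Q : IndexSet n m}
    (h : Q.Prec P) : schubertVariety b F e Q ⊆ schubertVariety b F e P := by
  have hreach := IndexSet.reachable_of_prec h
  clear h
  induction hreach with
  | refl => exact subset_rfl
  | tail _ hmove ih =>
    exact (zariskiClosure_subset (schubertCell_subset_of_move he hmove)).trans ih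

end ClosureRelations

section HyperbolicBases

open Matrix

variable {R K V κ : Type*} [CommRing R] [Field K] [AddCommGroup V] [Fintype κ] [DecidableEq κ]

lemma det_fromBlocks_eq_one {A B C D : Matrix κ κ R} (hAC : Aᵀ * C + Cᵀ * A = 0)
    (hAD : Aᵀ * D + Cᵀ * B = 1) (hA : IsUnit A.det) : (Matrix.fromBlocks A B C D).det = 1 := by
  have := Matrix.invertibleOfIsUnitDet A hA
  have hschur : Aᵀ * (D - C * ⅟A * B) = 1 := by
    rw [Matrix.mul_sub, ← Matrix.mul_assoc, ← Matrix.mul_assoc, eq_neg_of_add_eq_zero_left hAC,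
      Matrix.neg_mul, Matrix.mul_assoc Cᵀ, mul_invOf_self, Matrix.mul_one, Matrix.neg_mul,
      sub_neg_eq_add, hAD]
  have hdet := congrArg Matrix.det hschur
  rwa [Matrix.det_mul, Matrix.det_transpose, Matrix.det_one, ← Matrix.det_fromBlocks₁₁] at hdet

lemma det_eq_one_of_isUnit_toBlocks₁₁ [Module R V] {b : LinearMap.BilinForm R V}
    {β : Module.Basis (κ ⊕ κ) R V}
    (hβ : LinearMap.BilinForm.toMatrix β b = Matrix.fromBlocks 0 1 1 0) {g : V →ₗ[R] V}
    (hg : ∀ x y, b (g x) (g y) = b x y) (hunit : IsUnit (LinearMap.toMatrix β β g).toBlocks₁₁.det) :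
    LinearMap.det g = 1 := by
  have hcomp := LinearMap.BilinForm.toMatrix_comp β β b g g
  rw [show b.comp g g = b from LinearMap.ext₂ hg, hβ,
    ← Matrix.fromBlocks_toBlocks (LinearMap.toMatrix β β g), Matrix.fromBlocks_transpose,
    Matrix.fromBlocks_multiply, Matrix.fromBlocks_multiply, Matrix.fromBlocks_inj] at hcomp
  simp only [Matrix.mul_zero, Matrix.mul_one, zero_add, add_zero] at hcomp
  rw [← LinearMap.det_toMatrix β, ← Matrix.fromBlocks_toBlocks (LinearMap.toMatrix β β g)]
  exact det_fromBlocks_eq_one ((add_comm _ _).trans hcomp.1.symm)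
    ((add_comm _ _).trans hcomp.2.1.symm) hunit

lemma isUnit_det_toBlocks₁₁_of_disjoint {κ' : Type*} [Fintype κ'] [DecidableEq κ'] [Module K V]
    {β : Module.Basis (κ ⊕ κ') K V} {g : V ≃ₗ[K] V}
    (hg : Disjoint ((Submodule.span K (β '' Set.range Sum.inl)).map (g : V →ₗ[K] V))
      (Submodule.span K (β '' Set.range Sum.inr))) :
    IsUnit (LinearMap.toMatrix β β (g : V →ₗ[K] V)).toBlocks₁₁.det := by
  rw [isUnit_iff_ne_zero]
  intro hdet
  obtain ⟨v, hv0, hv⟩ := Matrix.exists_mulVec_eq_zero_iff.2 hdet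
  set x : V := ∑ k, v k • β (Sum.inl k)
  have hxl : x ∈ Submodule.span K (β '' Set.range Sum.inl) :=
    Submodule.sum_mem _ fun k _ => Submodule.smul_mem _ _ (Submodule.subset_span ⟨_, ⟨k, rfl⟩, rfl⟩)
  have hgx : g x ∈ Submodule.span K (β '' Set.range Sum.inr) := by
    rw [mem_span_basis_image]
    rintro (k | k) hk
    · have hvk := congrFun hv k
      simpa [x, Matrix.mulVec, dotProduct, Matrix.toBlocks₁₁, LinearMap.toMatrix_apply,
        mul_comm] using hvk
    · exact absurd ⟨k, rfl⟩ hk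
  have hx0 : x = 0 :=
    g.map_eq_zero_iff.1 (Submodule.disjoint_def.1 hg _ ⟨x, hxl, rfl⟩ hgx)
  exact hv0 (funext (Fintype.linearIndependent_iff.1
    (β.linearIndependent.comp _ Sum.inl_injective) v hx0))

lemma det_basis_equiv {ι : Type*} [Fintype ι] [DecidableEq ι] [Module R V] (e : Module.Basis ι R V)
    (σ : Equiv.Perm ι) :
    LinearMap.det (e.equiv e σ : V →ₗ[R] V) = ((Equiv.Perm.sign σ : ℤ) : R) := by
  have hmat : LinearMap.toMatrix e e (e.equiv e σ : V →ₗ[R] V) = (σ.permMatrix R)ᵀ := by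
    ext i j
    simp [LinearMap.toMatrix_apply, Finsupp.single_apply, PEquiv.toMatrix_apply, eq_comm]
  rw [← LinearMap.det_toMatrix e, hmat, Matrix.det_transpose, Matrix.det_permutation]

end HyperbolicBases

lemma ncard_modEq_of_even_symmDiff {α : Type*} [Finite α] {s t : Set α}
    (h : Even (symmDiff s t).ncard) : s.ncard ≡ t.ncard [MOD 2] := by
  have hs := Set.ncard_inter_add_ncard_sdiff_eq_ncard s t
  have ht := Set.ncard_inter_add_ncard_sdiff_eq_ncard t s
  rw [Set.symmDiff_def, Set.ncard_union_eq disjoint_sdiff_sdiff, Nat.even_iff] at h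
  rw [Set.inter_comm] at ht
  rw [Nat.ModEq]
  omega

section Lagrangian

variable {V : Type*} [AddCommGroup V] [Module ℂ V] {n : ℕ}
  {b : LinearMap.BilinForm ℂ V} {F : ℕ → Submodule ℂ V}
  {e : Module.Basis (Idx (2 * n + 2)) ℂ V}

/-- A set of indices that contains exactly one of `i` and `N + 1 - i` for each `i`, so that the
corresponding basis vectors span a maximal isotropic subspace. -/
def IsLagrangian (A : Set (Idx (2 * n + 2))) : Prop := ∀ i, dual i ∈ A ↔ i ∉ A

open Classical in
/-- The indices enumerated by a Lagrangian set `A` and its dual. -/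
def lagrangianEquiv {A : Set (Idx (2 * n + 2))} (hA : IsLagrangian A) :
    A ⊕ A ≃ Idx (2 * n + 2) where
  toFun := Sum.elim (fun i => i) (fun i => dual i)
  invFun i := if h : i ∈ A then Sum.inl ⟨i, h⟩ else Sum.inr ⟨dual i, (hA i).2 h⟩
  left_inv := by
    rintro (i | i)
    · simp
    · have hi : dual (i : Idx (2 * n + 2)) ∉ A := fun h => (hA _).1 h i.2
      simp [hi, dual_dual]
  right_inv i := by
    by_cases h : i ∈ A
    · simp [h]
    · simp [h, dual_dual]

lemma toMatrix_reindex_lagrangianEquiv (he : IsAdapted b (2 * n + 2) F e)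
    {A : Set (Idx (2 * n + 2))} (hA : IsLagrangian A) [DecidableEq A] [Fintype A] :
    LinearMap.BilinForm.toMatrix (e.reindex (lagrangianEquiv hA).symm) b =
      Matrix.fromBlocks 0 1 1 0 := by
  have hne (i j : A) : dual (i : Idx (2 * n + 2)) ≠ j := fun h => (hA i).1 (h ▸ j.2) i.2
  ext (i | i) (j | j) <;>
    simp [LinearMap.BilinForm.toMatrix_apply, he.apply_basis, lagrangianEquiv, dual_dual, hne,
      (hne _ _).symm, dual_injective.eq_iff, Matrix.one_apply, Subtype.val_inj]

lemma det_eq_one_of_disjoint_lagrangian (he : IsAdapted b (2 * n + 2) F e)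
    {A : Set (Idx (2 * n + 2))} (hA : IsLagrangian A) {g : V ≃ₗ[ℂ] V}
    (hg : ∀ x y, b (g x) (g y) = b x y)
    (hdisj : Disjoint ((Submodule.span ℂ (e '' A)).map (g : V →ₗ[ℂ] V))
      (Submodule.span ℂ (e '' Aᶜ))) :
    LinearMap.det (g : V →ₗ[ℂ] V) = 1 := by
  classical
  refine det_eq_one_of_isUnit_toBlocks₁₁ (toMatrix_reindex_lagrangianEquiv he hA) hg
    (isUnit_det_toBlocks₁₁_of_disjoint ?_)
  have hinl : e.reindex (lagrangianEquiv hA).symm '' Set.range Sum.inl = e '' A := by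
    ext x
    simp [lagrangianEquiv]
  have hinr : e.reindex (lagrangianEquiv hA).symm '' Set.range Sum.inr = e '' Aᶜ := by
    ext x
    simp only [Set.mem_image, Set.mem_range, exists_exists_eq_and, Set.mem_compl_iff]
    constructor
    · rintro ⟨i, rfl⟩
      exact ⟨dual i, fun h => (hA i).1 h i.2, by simp [lagrangianEquiv]⟩
    · rintro ⟨i, hi, rfl⟩
      exact ⟨⟨dual i, (hA i).2 hi⟩, by simp [lagrangianEquiv, dual_dual]⟩
  rwa [hinl, hinr]

open Classical in
/-- The involution of the indices that exchanges `i` and `N + 1 - i` for all `i` in the self-dual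
set `D`, and fixes the other indices. -/
def dualPerm (D : Set (Idx (2 * n + 2))) (hD : ∀ i, dual i ∈ D ↔ i ∈ D) :
    Equiv.Perm (Idx (2 * n + 2)) :=
  Function.Involutive.toPerm (fun i => if i ∈ D then dual i else i) fun i => by
    by_cases hi : i ∈ D <;> simp [hi, hD, dual_dual]

variable {D : Set (Idx (2 * n + 2))} (hD : ∀ i, dual i ∈ D ↔ i ∈ D)

open Classical in
lemma dualPerm_apply (i : Idx (2 * n + 2)) : dualPerm D hD i = if i ∈ D then dual i else i := rfl

lemma dual_dualPerm (i : Idx (2 * n + 2)) : dual (dualPerm D hD i) = dualPerm D hD (dual i) := by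
  rw [dualPerm_apply, dualPerm_apply]
  by_cases hi : i ∈ D <;> simp [hi, hD]

lemma ncard_eq_two_mul {D : Set (Idx (2 * n + 2))} (hD : ∀ i, dual i ∈ D ↔ i ∈ D) :
    D.ncard = 2 * {i : Idx (2 * n + 2) | (i : ℕ) ≤ n + 1 ∧ i ∈ D}.ncard := by
  have hupper : {i : Idx (2 * n + 2) | i ∈ D ∧ ¬(i : ℕ) ≤ n + 1} =
      dual '' {i : Idx (2 * n + 2) | (i : ℕ) ≤ n + 1 ∧ i ∈ D} := by
    ext i
    have hi := idx_bounds i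
    simp only [Set.mem_ofPred_eq, Set.mem_image]
    constructor
    · rintro ⟨hiD, hin⟩
      exact ⟨dual i, ⟨by rw [coe_dual]; omega, (hD i).2 hiD⟩, dual_dual i⟩
    · rintro ⟨j, ⟨hjn, hjD⟩, rfl⟩
      exact ⟨(hD j).2 hjD, by rw [coe_dual]; omega⟩
  have hsplit := Set.ncard_inter_add_ncard_sdiff_eq_ncard D {i : Idx (2 * n + 2) | (i : ℕ) ≤ n + 1}
  have hlower : D ∩ {i : Idx (2 * n + 2) | (i : ℕ) ≤ n + 1} =
      {i : Idx (2 * n + 2) | (i : ℕ) ≤ n + 1 ∧ i ∈ D} := Set.inter_comm _ _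
  rw [hlower, show D \ {i : Idx (2 * n + 2) | (i : ℕ) ≤ n + 1} = _ from hupper,
    Set.ncard_image_of_injective _ dual_injective] at hsplit
  omega

lemma sign_dualPerm : Equiv.Perm.sign (dualPerm D hD) =
    (-1) ^ {i : Idx (2 * n + 2) | (i : ℕ) ≤ n + 1 ∧ i ∈ D}.ncard := by
  classical
  have hsupport : (dualPerm D hD).support.card = D.ncard := by
    rw [← Set.ncard_coe_finset]
    congr 1
    ext i
    rw [Finset.mem_coe, Equiv.Perm.mem_support, dualPerm_apply]
    by_cases hi : i ∈ D <;> simp [hi, dual_ne_self]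
  have hsq : dualPerm D hD ^ 2 = 1 := by
    ext1 i
    exact Function.Involutive.toPerm_involutive _ i
  rw [Equiv.Perm.sign_of_pow_two_eq_one hsq, Equiv.Perm.card_fixedPoints,
    Nat.sub_sub_self (Equiv.Perm.sum_cycleType_le _), Equiv.Perm.sum_cycleType, hsupport,
    ncard_eq_two_mul hD, Nat.mul_div_cancel_left _ two_pos]

lemma dualPerm_isometry (he : IsAdapted b (2 * n + 2) F e) (x y : V) :
    b (e.equiv e (dualPerm D hD) x) (e.equiv e (dualPerm D hD) y) = b x y := by
  refine LinearMap.congr_fun₂ (e.ext fun i => e.ext fun j => ?_ :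
    b.comp (e.equiv e (dualPerm D hD)) (e.equiv e (dualPerm D hD)) = b) x y
  simp [he.apply_basis, dual_dualPerm]

lemma ncard_lagrangian_modEq (he : IsAdapted b (2 * n + 2) F e) {A C : Set (Idx (2 * n + 2))}
    (hA : IsLagrangian A) (hC : IsLagrangian C) {g : V ≃ₗ[ℂ] V}
    (hg : ∀ x y, b (g x) (g y) = b x y) (hdet : LinearMap.det (g : V →ₗ[ℂ] V) = 1)
    (hdisj : Disjoint ((Submodule.span ℂ (e '' A)).map (g : V →ₗ[ℂ] V))
      (Submodule.span ℂ (e '' Cᶜ))) :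
    {i : Idx (2 * n + 2) | (i : ℕ) ≤ n + 1 ∧ i ∈ A}.ncard ≡
      {i : Idx (2 * n + 2) | (i : ℕ) ≤ n + 1 ∧ i ∈ C}.ncard [MOD 2] := by
  set D : Set (Idx (2 * n + 2)) := {i | ¬(i ∈ A ↔ i ∈ C)} with hDdef
  have hD (i) : dual i ∈ D ↔ i ∈ D := by
    simp only [hDdef, Set.mem_ofPred_eq, hA i, hC i, not_iff_not]
  have himage : dualPerm D hD '' C = A := by
    ext i
    rw [Equiv.image_eq_preimage_symm, Set.mem_preimage,
      show (dualPerm D hD).symm i = dualPerm D hD i from rfl, dualPerm_apply]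
    split_ifs with hi
    · simp only [hDdef, Set.mem_ofPred_eq] at hi
      rw [hC]; tauto
    · simp only [hDdef, Set.mem_ofPred_eq, not_not] at hi
      exact hi.symm
  have hmap : (Submodule.span ℂ (e '' C)).map (e.equiv e (dualPerm D hD) : V →ₗ[ℂ] V) =
      Submodule.span ℂ (e '' A) := by
    rw [Submodule.map_span, ← himage, Set.image_image, Set.image_image]
    simp
  have hdet' := det_eq_one_of_disjoint_lagrangian he hC
    (g := (e.equiv e (dualPerm D hD)).trans g)
    (fun x y => by simp only [LinearEquiv.trans_apply, hg, dualPerm_isometry hD he])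
    (by rwa [LinearEquiv.coe_trans, Submodule.map_comp, hmap])
  rw [LinearEquiv.coe_trans, LinearMap.det_comp, hdet, one_mul, det_basis_equiv,
    sign_dualPerm] at hdet'
  have heven : Even {i : Idx (2 * n + 2) | (i : ℕ) ≤ n + 1 ∧ i ∈ D}.ncard := by
    rw [← neg_one_pow_eq_one_iff_even (R := ℂ) (by norm_num)]
    exact_mod_cast hdet'
  refine ncard_modEq_of_even_symmDiff ?_
  convert heven using 2
  ext i
  simp only [hDdef, Set.mem_symmDiff, Set.mem_ofPred_eq]
  tauto

end Lagrangian

section CellDimensions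

variable {V : Type*} [AddCommGroup V] [Module ℂ V] {n m : ℕ}
  {b : LinearMap.BilinForm ℂ V} {F : ℕ → Submodule ℂ V}
  {e : Module.Basis (Idx (2 * n + 2)) ℂ V} {Q : IndexSet n m} {S : Submodule ℂ V}

lemma IsAdapted.finrank_flag (he : IsAdapted b (2 * n + 2) F e) {k : ℕ} (hk : k ≤ 2 * n + 2) :
    Module.finrank ℂ (F k) = k := by
  have hset : {i : Idx (2 * n + 2) | (i : ℕ) ≤ k} = {i : Idx _ | (i : ℕ) ∈ Finset.Icc 1 k} := by
    ext i
    simp [(idx_bounds i).1]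
  rw [he.flag k hk, finrank_span_basis_image, hset,
    ncard_idx (Finset.Icc_subset_Icc_right hk), Nat.card_Icc, add_tsub_cancel_right]

lemma map_inf_flag {g : V ≃ₗ[ℂ] V} (hg : g ∈ borel b (2 * n + 2) F) {k : ℕ}
    (hk : k ≤ 2 * n + 2) (T : Submodule ℂ V) :
    T.map (g : V →ₗ[ℂ] V) ⊓ F k = (T ⊓ F k).map (g : V →ₗ[ℂ] V) := by
  rw [Submodule.map_inf _ g.injective, hg.2.2 k hk]

lemma finrank_inf_flag (he : IsAdapted b (2 * n + 2) F e) (hS : S ∈ schubertCell b F e Q) {k : ℕ}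
    (hk : k ≤ 2 * n + 2) : Module.finrank ℂ (S ⊓ F k : Submodule ℂ V) = Q.rank k := by
  obtain ⟨g, hg, rfl⟩ := hS
  have hset : {i : Idx (2 * n + 2) | (i : ℕ) ∈ Q.carrier} ∩ {i | (i : ℕ) ≤ k} =
      {i : Idx _ | (i : ℕ) ∈ Q.carrier ∩ Finset.Icc 1 k} := by
    ext i
    simp [(idx_bounds i).1]
  rw [map_inf_flag hg hk, LinearEquiv.finrank_map_eq, he.flag k hk, coordSubspace,
    span_basis_image_inf, finrank_span_basis_image, hset,
    ncard_idx (Finset.inter_subset_left.trans Q.subset_Icc)]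
  rfl

/-- The indices of the basis vectors in `(⟨e_p : p ∈ P⟩ + F_{c-1}) ∩ F_{c-1}^⊥`. -/
def IndexSet.lagrangian (P : IndexSet n m) (c : ℕ) : Set (Idx (2 * n + 2)) :=
  {i | (i : ℕ) < c ∨ ((i : ℕ) ≤ 2 * n + 3 - c ∧ (i : ℕ) ∈ P.carrier)}

lemma IndexSet.isLagrangian_lagrangian {P : IndexSet n m} {c : ℕ} (hc : c ≤ n + 1)
    (hsym : Finset.Icc c (n + 1) ⊆ P.sym) : IsLagrangian (P.lagrangian c) := by
  intro i
  have hi := idx_bounds i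
  have hdual (hiP : (i : ℕ) ∈ P.carrier) : 2 * n + 3 - i ∉ P.carrier := P.dual_notMem hiP
  have hmem (h : c ≤ i) (h' : (i : ℕ) ≤ 2 * n + 3 - c) :
      (i : ℕ) ∈ P.carrier ∨ 2 * n + 3 - i ∈ P.carrier := by
    rcases le_or_gt (i : ℕ) (n + 1) with hin | hin
    · exact (P.mem_sym hi.1 hi.2).1 (hsym (Finset.mem_Icc.2 ⟨h, hin⟩))
    · have := (P.mem_sym (by omega) (by omega)).1
        (hsym (Finset.mem_Icc.2 ⟨(by omega : c ≤ 2 * n + 3 - i), by omega⟩))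
      rwa [show 2 * n + 3 - (2 * n + 3 - (i : ℕ)) = i by omega, or_comm] at this
  simp only [IndexSet.lagrangian, Set.mem_ofPred_eq, coe_dual]
  by_cases hiP : (i : ℕ) ∈ P.carrier <;> by_cases hiP' : 2 * n + 3 - (i : ℕ) ∈ P.carrier <;>
    simp only [hiP, hiP', not_true, not_false_iff, or_false, or_true, and_true, and_false,
      imp_false, true_imp_iff] at hdual hmem ⊢ <;> omega

lemma IndexSet.ncard_lagrangian {P : IndexSet n m} {c : ℕ} (hc1 : 1 ≤ c) (hc : c ≤ n + 1) :
    {i : Idx (2 * n + 2) | (i : ℕ) ≤ n + 1 ∧ i ∈ P.lagrangian c}.ncard =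
      c - 1 + P.count c (n + 1) := by
  have hset : {i : Idx (2 * n + 2) | (i : ℕ) ≤ n + 1 ∧ i ∈ P.lagrangian c} =
      {i : Idx _ | (i : ℕ) ∈ Finset.Icc 1 (c - 1) ∪ P.carrier ∩ Finset.Icc c (n + 1)} := by
    ext i
    have := idx_bounds i
    simp only [IndexSet.lagrangian, Set.mem_ofPred_eq, Finset.mem_union, Finset.mem_inter,
      Finset.mem_Icc]
    by_cases hi : (i : ℕ) ∈ P.carrier <;> simp only [hi, true_and, and_true, false_and, and_false,
      or_false] <;> omega
  have hdisj : Disjoint (Finset.Icc 1 (c - 1)) (P.carrier ∩ Finset.Icc c (n + 1)) :=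
    Finset.disjoint_left.2 fun x hx hx' => by
      simp only [Finset.mem_inter, Finset.mem_Icc] at hx hx'
      omega
  rw [hset, ncard_idx, Finset.card_union_of_disjoint hdisj, Nat.card_Icc, add_tsub_cancel_right]
  · rfl
  · exact Finset.union_subset (Finset.Icc_subset_Icc_right (by omega))
      (Finset.inter_subset_left.trans P.subset_Icc)

lemma finrank_sup_inf_flag (he : IsAdapted b (2 * n + 2) F e) (hS : S ∈ schubertCell b F e Q)
    {c : ℕ} (hc1 : 1 ≤ c) (hc : c ≤ n + 1) :
    Module.finrank ℂ ((S ⊔ F (c - 1)) ⊓ F (n + 1) : Submodule ℂ V) =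
      c - 1 + Q.count c (n + 1) := by
  obtain ⟨g, hg, rfl⟩ := hS
  rw [← hg.2.2 (c - 1) (by omega), ← Submodule.map_sup, map_inf_flag hg (by omega),
    LinearEquiv.finrank_map_eq, he.flag (c - 1) (by omega), he.flag (n + 1) (by omega),
    coordSubspace, ← Submodule.span_union, ← Set.image_union, span_basis_image_inf,
    finrank_span_basis_image, ← IndexSet.ncard_lagrangian hc1 hc]
  congr 1
  ext i
  simp only [IndexSet.lagrangian, Set.mem_inter_iff, Set.mem_union, Set.mem_ofPred_eq]
  by_cases hi : (i : ℕ) ∈ Q.carrier <;>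
    simp only [hi, true_or, true_and, false_or, and_true, and_false, or_false] <;> omega

end CellDimensions

section Opposite

variable {V : Type*} [AddCommGroup V] [Module ℂ V] {n m : ℕ}
  {b : LinearMap.BilinForm ℂ V} {F : ℕ → Submodule ℂ V}
  {e : Module.Basis (Idx (2 * n + 2)) ℂ V} {P Q : IndexSet n m} {S : Submodule ℂ V}

/-- The coordinate subspace `⟨e_i : i ∉ Q⟩` complementary to `⟨e_q : q ∈ Q⟩`. A subspace meets it
trivially exactly when the Plücker coordinate indexed by `Q` does not vanish. -/
def opposite (e : Module.Basis (Idx (2 * n + 2)) ℂ V) (Q : IndexSet n m) : Submodule ℂ V :=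
  Submodule.span ℂ (e '' {i | (i : ℕ) ∉ Q.carrier})

lemma disjoint_opposite (he : IsAdapted b (2 * n + 2) F e) (hS : S ∈ schubertCell b F e Q) :
    Disjoint S (opposite e Q) := by
  obtain ⟨g, hg, rfl⟩ := hS
  rw [Submodule.disjoint_def]
  rintro _ ⟨x, hx, rfl⟩ hgx
  by_contra hgx0
  obtain ⟨q, hq0, hqmax⟩ := exists_leading_coord e (x := x) fun h => hgx0 (by simp [h])
  have hq := idx_bounds q
  have hqQ : (q : ℕ) ∈ Q.carrier := by
    by_contra h
    exact hq0 ((mem_span_basis_image e).1 hx q h)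
  have hmap {p : ℕ} (hp : p ≤ 2 * n + 2) : g x ∈ F p ↔ x ∈ F p := by
    conv_lhs => rw [← hg.2.2 p hp]
    exact g.injective.mem_set_image
  have hgxq := (he.mem_flag hq.2).1 ((hmap hq.2).2 ((he.mem_flag hq.2).2 hqmax))
  have hgxq' : g x ∈ F (q - 1) := by
    rw [he.mem_flag (by omega)]
    intro i hi
    rcases eq_or_ne i q with rfl | hiq
    · exact (mem_span_basis_image e).1 hgx i (not_not.2 hqQ)
    · have : (i : ℕ) ≠ q := fun h => hiq (Subtype.ext h)
      exact hgxq i (by omega)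
  exact hq0 ((he.mem_flag (by omega)).1 ((hmap (by omega)).1 hgxq') q (by omega))

lemma finrank_opposite_inf_flag (he : IsAdapted b (2 * n + 2) F e) (Q : IndexSet n m) {k : ℕ}
    (hk : k ≤ 2 * n + 2) :
    Module.finrank ℂ (opposite e Q ⊓ F k : Submodule ℂ V) + Q.rank k = k := by
  have hset : {i : Idx (2 * n + 2) | (i : ℕ) ∉ Q.carrier} ∩ {i | (i : ℕ) ≤ k} =
      {i : Idx _ | (i : ℕ) ∈ Finset.Icc 1 k \ Q.carrier} := by
    ext i
    simp [(idx_bounds i).1, and_comm]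
  have hcard := Finset.card_sdiff_add_card_inter (Finset.Icc 1 k) Q.carrier
  rw [Nat.card_Icc, Finset.inter_comm, add_tsub_cancel_right] at hcard
  rw [he.flag k hk, opposite, span_basis_image_inf, finrank_span_basis_image, hset,
    ncard_idx (Finset.sdiff_subset.trans (Finset.Icc_subset_Icc_right hk))]
  exact hcard

lemma finrank_sup_opposite (he : IsAdapted b (2 * n + 2) F e) (hS : S ∈ schubertCell b F e P)
    (hdisj : Disjoint S (opposite e Q)) {k : ℕ} (hk : k ≤ 2 * n + 2) :
    Module.finrank ℂ ((S ⊓ F k) ⊔ (opposite e Q ⊓ F k) : Submodule ℂ V) + Q.rank k =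
      P.rank k + k := by
  have : Module.Finite ℂ V := Module.Finite.of_basis e
  have hsum := Submodule.finrank_sup_add_finrank_inf_eq (S ⊓ F k) (opposite e Q ⊓ F k)
  have hopp := finrank_opposite_inf_flag he Q hk
  rw [(hdisj.mono inf_le_left inf_le_left).eq_bot, finrank_bot, finrank_inf_flag he hS hk] at hsum
  omega

lemma le_of_disjoint_opposite (he : IsAdapted b (2 * n + 2) F e) (hS : S ∈ schubertCell b F e P)
    (hdisj : Disjoint S (opposite e Q)) : Q.Le P := by
  have : Module.Finite ℂ V := Module.Finite.of_basis e
  refine IndexSet.le_iff_rank_le.2 fun k => ?_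
  rcases le_or_gt k (2 * n + 2) with hk | hk
  · have hsum := finrank_sup_opposite he hS hdisj hk
    have hle := Submodule.finrank_mono (R := ℂ)
      (sup_le inf_le_right inf_le_right : (S ⊓ F k) ⊔ (opposite e Q ⊓ F k) ≤ F k)
    rw [he.finrank_flag hk] at hle
    omega
  · rw [P.rank_of_le hk.le, Q.rank_of_le hk.le]

lemma flag_le_sup_opposite (he : IsAdapted b (2 * n + 2) F e) (hS : S ∈ schubertCell b F e P)
    (hdisj : Disjoint S (opposite e Q)) {k : ℕ} (hk : k ≤ 2 * n + 2)
    (hrank : Q.rank k = P.rank k) : F k ≤ S ⊔ (opposite e Q ⊓ F k) := by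
  have : Module.Finite ℂ V := Module.Finite.of_basis e
  have hsum := finrank_sup_opposite he hS hdisj hk
  have heq : (S ⊓ F k) ⊔ (opposite e Q ⊓ F k) = F k :=
    Submodule.eq_of_le_of_finrank_eq (sup_le inf_le_right inf_le_right)
      (by rw [he.finrank_flag hk]; omega)
  exact heq.symm.le.trans (sup_le_sup_right inf_le_left _)

lemma disjoint_sup_of_le_sup_inf {α : Type*} [Lattice α] [IsModularLattice α] [OrderBot α]
    {a x o y : α} (hao : Disjoint a o) (hx : x ≤ a ⊔ (o ⊓ x)) (hyo : y ≤ o) (hxy : Disjoint x y) :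
    Disjoint (a ⊔ x) y := by
  have hsup : a ⊔ x ≤ (o ⊓ x) ⊔ a := sup_le le_sup_right (hx.trans_eq (sup_comm _ _))
  have hle : (a ⊔ x) ⊓ y ≤ x := calc
    (a ⊔ x) ⊓ y ≤ ((o ⊓ x) ⊔ a) ⊓ o := inf_le_inf hsup hyo
    _ = (o ⊓ x) ⊔ a ⊓ o := sup_inf_assoc_of_le a inf_le_left
    _ ≤ x := by rw [hao.eq_bot, sup_bot_eq]; exact inf_le_right
  exact disjoint_iff_inf_le.2 ((le_inf hle inf_le_right).trans hxy.le_bot)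

lemma disjoint_map_lagrangian (he : IsAdapted b (2 * n + 2) F e) {g : V ≃ₗ[ℂ] V}
    (hg : g ∈ borel b (2 * n + 2) F)
    (hdisj : Disjoint ((coordSubspace e P).map (g : V →ₗ[ℂ] V)) (opposite e Q)) {c : ℕ}
    (hc1 : 1 ≤ c) (hc : c ≤ n + 1) (hrank : Q.rank (c - 1) = P.rank (c - 1)) :
    Disjoint ((Submodule.span ℂ (e '' P.lagrangian c)).map (g : V →ₗ[ℂ] V))
      (Submodule.span ℂ (e '' (Q.lagrangian c)ᶜ)) := by
  have hspan : Submodule.span ℂ (e '' P.lagrangian c) ≤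
      (coordSubspace e P ⊔ F (c - 1)) ⊓ F (2 * n + 3 - c) := by
    rw [Submodule.span_le]
    rintro _ ⟨i, hi | ⟨hi, hiP⟩, rfl⟩
    · exact ⟨Submodule.mem_sup_right (he.basis_mem_flag (by omega) (by omega)),
        he.basis_mem_flag (by omega) (by omega)⟩
    · exact ⟨Submodule.mem_sup_left (basis_mem_coordSubspace hiP),
        he.basis_mem_flag (by omega) hi⟩
  have hmap := Submodule.map_mono (f := (g : V →ₗ[ℂ] V)) hspan
  rw [← map_inf_flag hg (by omega), Submodule.map_sup, hg.2.2 (c - 1) (by omega)] at hmap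
  refine Disjoint.mono_left hmap ?_
  rw [disjoint_assoc]
  refine disjoint_sup_of_le_sup_inf hdisj
    (flag_le_sup_opposite he ⟨g, hg, rfl⟩ hdisj (by omega) hrank) ?_ ?_
  · rw [he.flag _ (by omega), span_basis_image_inf]
    exact Submodule.span_mono (Set.image_mono fun i hi hiQ => hi.2 (Or.inr ⟨hi.1, hiQ⟩))
  · refine Disjoint.mono_right inf_le_right ?_
    rw [he.flag _ (by omega), disjoint_iff, span_basis_image_inf, Submodule.span_eq_bot]
    rintro _ ⟨i, ⟨hi, hi'⟩, rfl⟩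
    exact absurd (Or.inl (by simp only [Set.mem_ofPred_eq] at hi; omega)) hi'

lemma prec_of_disjoint_opposite (he : IsAdapted b (2 * n + 2) F e) (hS : S ∈ schubertCell b F e P)
    (hdisj : Disjoint S (opposite e Q)) : Q.Prec P := by
  refine ⟨le_of_disjoint_opposite he hS hdisj, fun hcrit => ?_⟩
  obtain ⟨c, hc1, hc, hP, hQ, hrank⟩ := IndexSet.critical_iff.1 hcrit
  obtain ⟨g, hg, rfl⟩ := hS
  have hmod := ncard_lagrangian_modEq he (IndexSet.isLagrangian_lagrangian hc hP)
    (IndexSet.isLagrangian_lagrangian hc hQ) hg.1 hg.2.1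
    (disjoint_map_lagrangian he hg hdisj hc1 hc hrank)
  rw [IndexSet.ncard_lagrangian hc1 hc, IndexSet.ncard_lagrangian hc1 hc] at hmod
  rw [IndexSet.type_eq_iff_rank_modEq hcrit.type_ne_zero.2 hcrit.type_ne_zero.1,
    ← P.rank_add_count hc1 (hc.trans n.succ.le_succ),
    ← Q.rank_add_count hc1 (hc.trans n.succ.le_succ), hrank]
  exact hmod.symm.add_left_cancel'.add_left _

end Opposite

section Plucker

variable {V : Type*} [AddCommGroup V] [Module ℂ V] {N n m : ℕ}
  {b : LinearMap.BilinForm ℂ V} {F : ℕ → Submodule ℂ V}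

lemma plucker_eq_zero_iff {e : Module.Basis (Idx N) ℂ V} {v : Fin m → V}
    (hv : LinearIndependent ℂ v) (I : Fin m → Idx N) :
    plucker e v I = 0 ↔
      ¬Disjoint (Submodule.span ℂ (Set.range v)) (Submodule.span ℂ (e '' (Set.range I)ᶜ)) := by
  have hcoord (a : Fin m → ℂ) (s : Fin m) : e.repr (∑ r, a r • v r) (I s) =
      Matrix.vecMul a (Matrix.of fun r s : Fin m => e.repr (v r) (I s)) s := by
    simp [Matrix.vecMul, dotProduct, Finsupp.finsetSum_apply]
  have hmem (a : Fin m → ℂ) : ∑ r, a r • v r ∈ Submodule.span ℂ (e '' (Set.range I)ᶜ) ↔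
      Matrix.vecMul a (Matrix.of fun r s : Fin m => e.repr (v r) (I s)) = 0 := by
    simp [mem_span_basis_image, funext_iff, ← hcoord]
  rw [plucker, ← Matrix.exists_vecMul_eq_zero_iff, Submodule.disjoint_def]
  push Not
  constructor
  · rintro ⟨a, ha0, ha⟩
    exact ⟨∑ r, a r • v r, (Submodule.mem_span_range_iff_exists_fun ℂ).2 ⟨a, rfl⟩, (hmem a).2 ha,
      fun h => ha0 (funext (Fintype.linearIndependent_iff.1 hv a h))⟩
  · rintro ⟨x, hx, hxI, hx0⟩
    obtain ⟨a, rfl⟩ := (Submodule.mem_span_range_iff_exists_fun ℂ).1 hx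
    exact ⟨a, fun ha => hx0 (by simp [ha]), (hmem a).1 hxI⟩

lemma exists_linearIndependent_span_eq {K W : Type*} [DivisionRing K] [AddCommGroup W] [Module K W]
    [Module.Finite K W] {S : Submodule K W} (hS : Module.finrank K S = m) :
    ∃ v : Fin m → W, LinearIndependent K v ∧ Submodule.span K (Set.range v) = S := by
  let β := Module.finBasisOfFinrankEq K S hS
  refine ⟨fun r => β r, β.linearIndependent.map' S.subtype S.ker_subtype, ?_⟩
  rw [show (fun r => (β r : W)) = S.subtype ∘ β from rfl, Set.range_comp, ← Submodule.map_span,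
    β.span_eq, Submodule.map_subtype_top]

/-- The elements of `Q` in increasing order, as indices of basis vectors. -/
def IndexSet.seq (Q : IndexSet n m) (j : Fin m) : Idx (2 * n + 2) :=
  ⟨Q.elt j, Q.subset_Icc (Q.elt_mem j)⟩

lemma IndexSet.range_seq (Q : IndexSet n m) :
    Set.range Q.seq = {i : Idx _ | (i : ℕ) ∈ Q.carrier} := by
  ext i
  refine ⟨?_, fun hi => ?_⟩
  · rintro ⟨j, rfl⟩
    exact Q.elt_mem j
  · obtain ⟨j, hj⟩ := Q.exists_elt_eq hi
    exact ⟨j, Subtype.ext hj⟩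

variable {e : Module.Basis (Idx (2 * n + 2)) ℂ V} {P Q : IndexSet n m} {S : Submodule ℂ V}

lemma plucker_seq_eq_zero_iff {v : Fin m → V} (hv : LinearIndependent ℂ v) (Q : IndexSet n m) :
    plucker e v Q.seq = 0 ↔ ¬Disjoint (Submodule.span ℂ (Set.range v)) (opposite e Q) := by
  rw [plucker_eq_zero_iff hv, Q.range_seq]
  rfl

lemma exists_disjoint_opposite_of_mem_zariskiClosure {A : Set (Submodule ℂ V)}
    (hS : S ∈ zariskiClosure b m e A) (hSQ : Disjoint S (opposite e Q)) :
    ∃ T ∈ A, Disjoint T (opposite e Q) := by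
  have : Module.Finite ℂ V := Module.Finite.of_basis e
  by_contra! hA
  obtain ⟨v, hv, rfl⟩ := exists_linearIndependent_span_eq hS.1.1
  have hvanish := hS.2 1 (MvPolynomial.X Q.seq) (MvPolynomial.isHomogeneous_X _ _) (by
    rintro T hT w hw rfl
    rw [MvPolynomial.eval_X, plucker_seq_eq_zero_iff hw]
    exact hA _ hT) v hv rfl
  rw [MvPolynomial.eval_X, plucker_seq_eq_zero_iff hv] at hvanish
  exact hvanish hSQ

end Plucker

section SchubertVarieties

variable {V : Type*} [AddCommGroup V] [Module ℂ V] {n m : ℕ}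
  {b : LinearMap.BilinForm ℂ V} {F : ℕ → Submodule ℂ V}
  {e : Module.Basis (Idx (2 * n + 2)) ℂ V} {P Q : IndexSet n m} {S : Submodule ℂ V}

lemma mem_schubertVariety_iff (he : IsAdapted b (2 * n + 2) F e) (hS : S ∈ schubertCell b F e Q) :
    S ∈ schubertVariety b F e P ↔ Q.Prec P := by
  refine ⟨fun hSP => ?_, fun h => schubertVariety_subset_of_prec he h
    (subset_zariskiClosure (schubertCell_subset_OG he Q) hS)⟩
  obtain ⟨T, hT, hdisj⟩ :=
    exists_disjoint_opposite_of_mem_zariskiClosure hSP (disjoint_opposite he hS)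
  exact prec_of_disjoint_opposite he hT hdisj

lemma mem_schubertY_iff (he : IsAdapted b (2 * n + 2) F e) (hS : S ∈ schubertCell b F e Q) :
    S ∈ schubertY b F P ↔ ∀ k ≠ n + 1, P.rank k ≤ Q.rank k := by
  simp only [← IndexSet.lt_rank_barElt_iff, schubertY, Set.mem_ofPred_eq,
    schubertCell_subset_OG he Q hS, true_and, finrank_inf_flag he hS (P.barElt_le _),
    Nat.succ_le_iff]

lemma parityConditions_iff (he : IsAdapted b (2 * n + 2) F e) (hS : S ∈ schubertCell b F e Q) :
    ParityConditions F P S ↔ ∀ c, 1 ≤ c → c ≤ n + 1 → Finset.Icc c (n + 1) ⊆ P.sym →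
      P.rank (c - 1) < Q.rank (c - 1) ∨ Q.count c (n + 1) ≡ P.count c (n + 1) [MOD 2] := by
  refine forall₃_congr fun c hc1 hc => ?_
  rw [finrank_inf_flag he hS (by omega), finrank_sup_inf_flag he hS hc1 hc, IndexSet.rank]
  exact imp_congr_right fun _ => or_congr_right
    ⟨fun h => h.add_left_cancel', fun h => h.add_left _⟩

lemma eq_of_forall_mem_schubertCell (he : IsAdapted b (2 * n + 2) F e) {X Y : Set (Submodule ℂ V)}
    (hX : X ⊆ OG b m) (hY : Y ⊆ OG b m)
    (h : ∀ Q : IndexSet n m, ∀ S ∈ schubertCell b F e Q, S ∈ X ↔ S ∈ Y) : X = Y := by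
  ext S
  refine ⟨fun hS => ?_, fun hS => ?_⟩
  · obtain ⟨Q, hQ⟩ := exists_mem_schubertCell he (hX hS)
    exact (h Q S hQ).1 hS
  · obtain ⟨Q, hQ⟩ := exists_mem_schubertCell he (hY hS)
    exact (h Q S hQ).2 hS

lemma schubertVariety_subset_OG : schubertVariety b F e P ⊆ OG b m := fun _ hS => hS.1

lemma schubertY_subset_OG : schubertY b F P ⊆ OG b m := fun _ hS => hS.1

lemma schubertVariety_subset_iff (he : IsAdapted b (2 * n + 2) F e) :
    schubertVariety b F e Q ⊆ schubertVariety b F e P ↔ Q.Prec P := by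
  refine ⟨fun h => ?_, schubertVariety_subset_of_prec he⟩
  have hQ := coordSubspace_mem_schubertCell (b := b) (F := F) (e := e) Q
  exact (mem_schubertVariety_iff he hQ).1
    (h (subset_zariskiClosure (schubertCell_subset_OG he Q) hQ))

end SchubertVarieties

end EvenOG

end

open EvenOG in
theorem mainTheorem11_general {V : Type*} [AddCommGroup V] [Module ℂ V] (n m : ℕ)
    (b : LinearMap.BilinForm ℂ V) (F : ℕ → Submodule ℂ V)
    (e : Module.Basis (Idx (2 * n + 2)) ℂ V) (he : IsAdapted b (2 * n + 2) F e) :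
    (∀ P : IndexSet n m,
      schubertVariety b F e P = {S | S ∈ schubertY b F P ∧ ParityConditions F P S}) ∧
    (∀ P : IndexSet n m, P.type = 0 → schubertVariety b F e P = schubertY b F P) ∧
    (∀ P : IndexSet n m, 0 < P.type →
      schubertVariety b F e P ∪ schubertVariety b F e P.iota = schubertY b F P) ∧
    (∀ P Q : IndexSet n m, schubertVariety b F e Q ⊆ schubertVariety b F e P ↔ Q.Prec P) := by
  refine ⟨fun P => ?_, fun P hP => ?_, fun P hP => ?_, fun P Q => schubertVariety_subset_iff he⟩
  · refine eq_of_forall_mem_schubertCell he schubertVariety_subset_OG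
      (fun S hS => schubertY_subset_OG hS.1) fun Q S hS => ?_
    rw [mem_schubertVariety_iff he hS, Set.mem_ofPred_eq, mem_schubertY_iff he hS,
      parityConditions_iff he hS, IndexSet.prec_iff_parity]
  · refine eq_of_forall_mem_schubertCell he schubertVariety_subset_OG schubertY_subset_OG
      fun Q S hS => ?_
    rw [mem_schubertVariety_iff he hS, mem_schubertY_iff he hS,
      IndexSet.prec_iff_of_type_eq_zero hP]
  · refine eq_of_forall_mem_schubertCell he
      (Set.union_subset schubertVariety_subset_OG schubertVariety_subset_OG) schubertY_subset_OG
      fun Q S hS => ?_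
    rw [Set.mem_union, mem_schubertVariety_iff he hS, mem_schubertVariety_iff he hS,
      mem_schubertY_iff he hS, IndexSet.prec_or_prec_iota_iff hP.ne']

theorem mainTheorem11 {V : Type*} [AddCommGroup V] [Module ℂ V] (n m : ℕ) (hm : m < n + 1)
    (b : LinearMap.BilinForm ℂ V) (hsymm : b.IsSymm) (hnondeg : b.Nondegenerate)
    (F : ℕ → Submodule ℂ V) (hF : EvenOG.IsIsotropicFlag b (2 * n + 2) F)
    (e : Module.Basis (EvenOG.Idx (2 * n + 2)) ℂ V)
    (he : EvenOG.IsAdapted b (2 * n + 2) F e) :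
    (∀ P : EvenOG.IndexSet n m,
      EvenOG.schubertVariety b F e P =
        {S | S ∈ EvenOG.schubertY b F P ∧ EvenOG.ParityConditions F P S}) ∧
    (∀ P : EvenOG.IndexSet n m, P.type = 0 →
      EvenOG.schubertVariety b F e P = EvenOG.schubertY b F P) ∧
    (∀ P : EvenOG.IndexSet n m, 0 < P.type →
      EvenOG.schubertVariety b F e P ∪ EvenOG.schubertVariety b F e P.iota =
        EvenOG.schubertY b F P) ∧
    (∀ P Q : EvenOG.IndexSet n m,
      EvenOG.schubertVariety b F e Q ⊆ EvenOG.schubertVariety b F e P ↔ Q.Prec P) :=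
  mainTheorem11_general n m b F e he
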